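/- **Setting.** Let $\mathbb F$ be a field, $R=\mathbb F[x_1,\dots,x_n]$, $\mathbb M$ its set of monomials, $\prec$ an admissible ordering of $\mathbb M$, and $\operatorname{lt}(p)$, $\operatorname{lc}(p)$ the head monomial and head coefficient of $p\ne0$. Let $F=(f_1,\dots,f_m)$ be a list of nonzero polynomials of $R$. For $p,q\neq 0$ put $u_{p,q}=\operatorname{lcm}(\operatorname{lt}p,\operatorname{lt}q)/\operatorname{lt}p$. The $S$-polynomial is $\operatorname{Spol}(p,q)=\operatorname{lc}(q)u_{p,q}\,p-\operatorname{lc}(p)u_{q,p}\,q$, and $u_{p,q}p$, $u_{q,p}q$ are its components. **Signatures.** $\mu\mathbf e_\nu$ ($\mu\in\mathbb M$, $1\le\nu\le m$) is *a signature* of $p$ if $p=\sum_j h_jf_j$ with $h_{\nu+1}=\dots=h_m=0$, $h_\nu\ne0$ and $\operatorname{lt}(h_\nu)=\mu$; $\nu$ is its index. Signatures are ordered by $\mu'\mathbf e_{\nu'}\prec\mu\mathbf e_\nu$ iff $\nu'<\nu$, or $\nu'=\nu$ and $\mu'\prec\mu$. The minimal signature of a nonzero $p\in\langle F\rangle$ is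 its smallest one. Put $u\cdot\mu\mathbf e_\nu=(u\mu)\mathbf e_\nu$. **The algorithm F5.** It keeps a list $r$ of labeled polynomials $r_k=(\operatorname{sig}(k),\operatorname{poly}(k))$ and, for each index $\nu$, a list $\mathit{Rules}_\nu$ of pairs $(\mu,j)$. "Recording" $(\mu\mathbf e_\nu,p)$ means appending it to $r$ and then appending $(\mu,\#r)$ to $\mathit{Rules}_\nu$. With $\operatorname{sig}(k)=\mu_k\mathbf e_\nu$, the test *Is_Rewritable*$(u,k)$ is true if some $(\mu,j)\in\mathit{Rules}_\nu$ has $\mu\mid u\mu_k$ and the last such pair has $j\ne k$. Choices left open below (the order of ties and of loops over sets, the choice of a reductor) are arbitrary. *Main loop.* Start with $r=((\mathbf e_1,f_1/\operatorname{lc}f_1))$, empty rules, $G_{prev}=\{1\}$, $B=\{f_1\}$. For $i=2,\dots,m$: append $(\mathbf e_i,f_i/\operatorname{lc}f_i)$ to $r$ (recording no rule), let $G_{curr}$ be the output of *Partial_Basis*$(i,B,G_{prev})$ ("iteration $i$"); stop if $\operatorname{poly}(k)=1$ for some $k\in G_{curr}$; otherwise put $G_{prev}:=G_{curr}$, $B:=\{\operatorname{poly}(k):k\in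 G_{curr}\}$. *Partial_Basis*$(i,B,G_{prev})$. Put $c=\#r$, $G_{curr}=G_{prev}\cup\{c\}$, $P=\bigcup_{j\in G_{prev}}\mathit{Critical\_Pair}(c,j)$. While $P\ne\emptyset$: remove from $P$ the pairs $(t,k,u,\ell,v)$ with $t$ of least total degree; apply *SPols* to them, and *Reduction* to its output; then for each $k$ returned, add $\bigcup_{j\in G_{curr}}\mathit{Critical\_Pair}(k,j)$ to $P$ and $k$ to $G_{curr}$. Return $G_{curr}$. *Critical_Pair*$(k,\ell)$. Let $p=\operatorname{poly}(k)$, $q=\operatorname{poly}(\ell)$, $t=\operatorname{lcm}(\operatorname{lt}p,\operatorname{lt}q)$, $u=u_{p,q}$, $v=u_{q,p}$. Return $\emptyset$ if $u\operatorname{sig}(k)$ or $v\operatorname{sig}(\ell)$ has index $i$ and a monomial divisible by $\operatorname{lt}(\operatorname{poly}(j))$ for some $j\in G_{prev}$. Otherwise return $\{(t,\ell,v,k,u)\}$ if $u\operatorname{sig}(k)\prec v\operatorname{sig}(\ell)$, and $\{(t,k,u,\ell,v)\}$ if not. *SPols*. For each given $(t,k,u,\ell,v)$, by increasing $t$: if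 neither *Is_Rewritable*$(u,k)$ nor *Is_Rewritable*$(v,\ell)$, record $(u\operatorname{sig}(k),\operatorname{Spol}(\operatorname{poly}(k),\operatorname{poly}(\ell)))$. Return the indices of the nonzero polynomials so recorded. *Reduction*. Let $T$ be the given set of indices and $C=\emptyset$. While $T\neq\emptyset$: remove from $T$ an index $k$ with minimal $\operatorname{sig}(k)$, and replace $\operatorname{poly}(k)$ by a normal form modulo $B$. If $p=\operatorname{poly}(k)$ is $0$, continue. Otherwise look for a reductor: some $j\in G_{curr}\cup C$ such that $q=\operatorname{poly}(j)$ satisfies $\operatorname{lt}(q)\mid\operatorname{lt}(p)$ and, with $w=\operatorname{lt}(p)/\operatorname{lt}(q)$, $w\operatorname{sig}(j)\ne\operatorname{sig}(k)$, *Is_Rewritable*$(w,j)$ is false, and the monomial of $w\operatorname{sig}(j)$ is divisible by no $\operatorname{lt}(\operatorname{poly}(l))$, $l\in G_{prev}$. If there is none, make $\operatorname{poly}(k)$ monic and add $k$ to $C$. If there is one, let $p'=p-\frac{\operatorname{lc}p}{\operatorname{lc}q}wq$, made monic if nonzero; if $w\operatorname{sig}(j)\prec\operatorname{sig}(k)$,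 put $\operatorname{poly}(k):=p'$ and return $k$ to $T$; otherwise record $(w\operatorname{sig}(j),p')$ and add $k$ and the new index to $T$. Finally return $C$. **Theorem (new characterization of a Gröbner basis).** Suppose that in a run of F5 on $F$ iteration $i$ of *Partial_Basis* terminates with output $G_{curr}$, and let $\mathcal G=(\operatorname{poly}(\lambda))_{\lambda\in G_{curr}}$, all data being taken at that moment. Suppose that for all distinct $a,b\in G_{curr}$ the $S$-polynomial $S$ of $\operatorname{poly}(a)$ and $\operatorname{poly}(b)$ satisfies (A) or (B): - (A) $S$ has a *signature-preserving $S$-representation* with respect to $\mathcal G$: there are a signature $\sigma$ of $S$, polynomials $h_\lambda$ $(\lambda\in G_{curr})$ and a monomial $t\prec\operatorname{lcm}(\operatorname{lt}\operatorname{poly}(a),\operatorname{lt}\operatorname{poly}(b))$ such that $S=\sum_\lambda h_\lambda\operatorname{poly}(\lambda)$, such that $\operatorname{lt}(h_\lambda\operatorname{poly}(\lambda))\preceq t$ whenever $h_\lambda\ne0$, and such that for exactly one $\lambda'\in G_{curr}$, which satisfies $\lambda'>a,b$ and $h_{\lambda'}\neq0$, one has $\operatorname{lt}(h_{\lambda'})\operatorname{sig}(\lambda')=\sigma$,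 while $h_\lambda=0$ or $\operatorname{lt}(h_\lambda)\operatorname{sig}(\lambda)\prec\sigma$ for all $\lambda\ne\lambda'$; - (B) a component $u\operatorname{poly}(k)$ of $S$ ($k\in\{a,b\}$) satisfies - (B1) $u\operatorname{sig}(k)$ has index $i$ but is not the minimal signature of $u\operatorname{poly}(k)$; or - (B2) $u\operatorname{sig}(k)$ is rewritable in the rules: with $\operatorname{sig}(k)=\mu_k\mathbf e_\nu$, the list $\mathit{Rules}_\nu$ has an entry $(\mu,j)$ with $\mu\mid u\mu_k$, and its last such entry has $j\ne k$ (and $\operatorname{sig}(j)=\mu\mathbf e_\nu$). Then $\mathcal G$ is a Gröbner basis of $\langle f_1,\dots,f_i\rangle$: it generates this ideal, and the head monomial of every nonzero element of the ideal is divisible by the head monomial of some (nonzero) element of $\mathcal G$. -/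

import Mathlib

open MvPolynomial
open scoped MonomialOrder

namespace F5

noncomputable section

/-! ### Signatures

Monomials of `𝕜[x₁,…,xₙ]` are their exponent vectors `Fin n →₀ ℕ`: the product is `+`,
divisibility is `≤`, the least common multiple is `⊔`, an exact quotient is `-`.  The head monomial
of `p` is `m.degree p` and its head coefficient is `m.leadingCoeff p`.  The input `f₁,…,f_M` is
given by the values of `f : ℕ → MvPolynomial (Fin n) 𝕜` at `1,…,M`. -/

/-- The signature `μ e_ν`. -/
structure Sig (n : ℕ) where
  mono : Fin n →₀ ℕ
  idx : ℕ

/-- The natural signature `u · (μ e_ν) = (u μ) e_ν` of a product. -/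
def Sig.mul {n : ℕ} (u : Fin n →₀ ℕ) (s : Sig n) : Sig n := ⟨u + s.mono, s.idx⟩

/-- The strict order on signatures: first by index, then by monomial. -/
def Sig.LT {n : ℕ} (m : MonomialOrder (Fin n)) (s t : Sig n) : Prop :=
  s.idx < t.idx ∨ (s.idx = t.idx ∧ s.mono ≺[m] t.mono)

section Polynomials

variable {n : ℕ} {𝕜 : Type*} [Field 𝕜]

/-- `s = μ e_ν` is a signature of `p` with respect to `(f₁,…,f_M)`: one can write
`p = h₁ f₁ + ⋯ + h_M f_M` with `h_{ν+1} = ⋯ = h_M = 0` and `h_ν ≠ 0` of head monomial `μ`. -/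
def IsSignature (m : MonomialOrder (Fin n)) (M : ℕ) (f : ℕ → MvPolynomial (Fin n) 𝕜)
    (p : MvPolynomial (Fin n) 𝕜) (s : Sig n) : Prop :=
  1 ≤ s.idx ∧ s.idx ≤ M ∧ ∃ h : ℕ → MvPolynomial (Fin n) 𝕜,
    p = ∑ j ∈ Finset.Icc 1 M, h j * f j ∧
    (∀ j, s.idx < j → j ≤ M → h j = 0) ∧
    h s.idx ≠ 0 ∧ m.degree (h s.idx) = s.mono

/-- `s` is the minimal signature of `p`.  (The minimal signature of the zero polynomial is the zero
signature, which is smaller than every `μ e_ν`; hence the clause `p ≠ 0`.) -/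
def IsMinimalSignature (m : MonomialOrder (Fin n)) (M : ℕ) (f : ℕ → MvPolynomial (Fin n) 𝕜)
    (p : MvPolynomial (Fin n) 𝕜) (s : Sig n) : Prop :=
  p ≠ 0 ∧ IsSignature m M f p s ∧ ∀ t : Sig n, IsSignature m M f p t → ¬ t.LT m s

/-- The multiplier `lcm(lt p, lt q) / lt p`. -/
def ltmul (m : MonomialOrder (Fin n)) (p q : MvPolynomial (Fin n) 𝕜) : Fin n →₀ ℕ :=
  (m.degree p ⊔ m.degree q) - m.degree p

/-- The `S`-polynomial of `p` and `q`. -/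
def sPol (m : MonomialOrder (Fin n)) (p q : MvPolynomial (Fin n) 𝕜) : MvPolynomial (Fin n) 𝕜 :=
  monomial (ltmul m p q) (m.leadingCoeff q) * p - monomial (ltmul m q p) (m.leadingCoeff p) * q

/-- `p` divided by its head coefficient (and `0` for `p = 0`). -/
def monic (m : MonomialOrder (Fin n)) (p : MvPolynomial (Fin n) 𝕜) : MvPolynomial (Fin n) 𝕜 :=
  C (m.leadingCoeff p)⁻¹ * p

/-- The finite family `(g_k)_{k ∈ G}` is a Gröbner basis of the ideal `I`. -/
def IsGroebnerBasis (m : MonomialOrder (Fin n)) (I : Ideal (MvPolynomial (Fin n) 𝕜))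
    (G : Finset ℕ) (g : ℕ → MvPolynomial (Fin n) 𝕜) : Prop :=
  Ideal.span {p | ∃ k ∈ G, p = g k} = I ∧
  ∀ p ∈ I, p ≠ 0 → ∃ k ∈ G, g k ≠ 0 ∧ m.degree (g k) ≤ m.degree p

/-- One reduction step of `p` modulo `B`: a term of `p` whose monomial is divisible by the head
monomial of some `b ∈ B` is cancelled by a multiple of `b`. -/
def RedStep (m : MonomialOrder (Fin n)) (B : Set (MvPolynomial (Fin n) 𝕜))
    (p q : MvPolynomial (Fin n) 𝕜) : Prop :=
  ∃ b ∈ B, b ≠ 0 ∧ ∃ s ∈ p.support, m.degree b ≤ s ∧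
    q = p - monomial (s - m.degree b) (p.coeff s / m.leadingCoeff b) * b

/-- `h` is a normal form (result of a complete reduction) of `p` modulo `B`. -/
def IsNormalForm (m : MonomialOrder (Fin n)) (B : Set (MvPolynomial (Fin n) 𝕜))
    (p h : MvPolynomial (Fin n) 𝕜) : Prop :=
  Relation.ReflTransGen (RedStep m B) p h ∧ ∀ h', ¬ RedStep m B h h'

end Polynomials

/-! ### The data of the algorithm -/

/-- The global variables.  The list `r` of labeled polynomials has length `size`, and its `k`-th
entry (`1 ≤ k ≤ size`) is `(sig k, poly k)`.  The list `Rules_ν` is `rules ν`; its entries are pairs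
`(μ, j)`, the most recent one last. -/
structure State (n : ℕ) (𝕜 : Type*) [Field 𝕜] where
  size : ℕ
  sig : ℕ → Sig n
  poly : ℕ → MvPolynomial (Fin n) 𝕜
  rules : ℕ → List ((Fin n →₀ ℕ) × ℕ)

/-- A critical pair `(t, k, u, ℓ, v)`. -/
structure CritPair (n : ℕ) where
  t : Fin n →₀ ℕ
  k : ℕ
  u : Fin n →₀ ℕ
  l : ℕ
  v : Fin n →₀ ℕ

section Algorithm

variable {n : ℕ} {𝕜 : Type*} [Field 𝕜]

/-- Append `(s, p)` to `r`. -/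
def State.append (st : State n 𝕜) (s : Sig n) (p : MvPolynomial (Fin n) 𝕜) : State n 𝕜 :=
  { st with
    size := st.size + 1
    sig := Function.update st.sig (st.size + 1) s
    poly := Function.update st.poly (st.size + 1) p }

/-- `r_k := (sig k, p)`. -/
def State.setPoly (st : State n 𝕜) (k : ℕ) (p : MvPolynomial (Fin n) 𝕜) : State n 𝕜 :=
  { st with poly := Function.update st.poly k p }

/-- `Add_Rule (s, j)`. -/
def State.addRule (st : State n 𝕜) (s : Sig n) (j : ℕ) : State n 𝕜 :=
  { st with rules := Function.update st.rules s.idx (st.rules s.idx ++ [(s.mono, j)]) }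

/-- Append `(s, p)` to `r` and then record the rule `(s, #r)`. -/
def State.appendWithRule (st : State n 𝕜) (s : Sig n) (p : MvPolynomial (Fin n) 𝕜) : State n 𝕜 :=
  (st.append s p).addRule s (st.size + 1)

/-- `Find_Rewriting (u, k)`: the index in the most recent rule of the right list whose monomial
divides `u · μ_k`, and `k` if there is none. -/
def findRewriting (st : State n 𝕜) (u : Fin n →₀ ℕ) (k : ℕ) : ℕ :=
  match (st.rules (st.sig k).idx).reverse.find? (fun ρ => decide (ρ.1 ≤ u + (st.sig k).mono)) with
  | some ρ => ρ.2
  | none => k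

/-- `Is_Rewritable (u, k)`. -/
def isRewritable (st : State n 𝕜) (u : Fin n →₀ ℕ) (k : ℕ) : Prop :=
  findRewriting st u k ≠ k

/-- The monomial `w` is top-reducible by the polynomials indexed by `G`. -/
def TopReducible (m : MonomialOrder (Fin n)) (st : State n 𝕜) (G : Finset ℕ)
    (w : Fin n →₀ ℕ) : Prop :=
  ∃ j ∈ G, m.degree (st.poly j) ≤ w

open Classical in
/-- `Critical_Pair (k, ℓ, i, Gprev)`: the empty set or one critical pair. -/
def critPair (m : MonomialOrder (Fin n)) (st : State n 𝕜) (i : ℕ) (Gprev : Finset ℕ) (k l : ℕ) :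
    Set (CritPair n) :=
  let t := m.degree (st.poly k) ⊔ m.degree (st.poly l)
  let u₁ := t - m.degree (st.poly k)
  let u₂ := t - m.degree (st.poly l)
  if (st.sig k).idx = i ∧ TopReducible m st Gprev (u₁ + (st.sig k).mono) then ∅
  else if (st.sig l).idx = i ∧ TopReducible m st Gprev (u₂ + (st.sig l).mono) then ∅
  else if ((st.sig k).mul u₁).LT m ((st.sig l).mul u₂) then {⟨t, l, u₂, k, u₁⟩}
  else {⟨t, k, u₁, l, u₂⟩}

open Classical in
/-- The body of the loop of `SPols`, for the critical pair `c`; the second component is the set of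
indices of the nonzero `S`-polynomials found so far. -/
def sPolsStep (m : MonomialOrder (Fin n)) (x : State n 𝕜 × Finset ℕ) (c : CritPair n) :
    State n 𝕜 × Finset ℕ :=
  if ¬ isRewritable x.1 c.u c.k ∧ ¬ isRewritable x.1 c.v c.l then
    let s := sPol m (x.1.poly c.k) (x.1.poly c.l)
    (x.1.appendWithRule ((x.1.sig c.k).mul c.u) s,
      if s ≠ 0 then insert (x.1.size + 1) x.2 else x.2)
  else x

/-- `SPols`, for the critical pairs taken in the order of the list `L`. -/
def sPols (m : MonomialOrder (Fin n)) (st : State n 𝕜) (L : List (CritPair n)) :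
    State n 𝕜 × Finset ℕ :=
  L.foldl (sPolsStep m) (st, ∅)

/-- `j` passes the tests of `Find_Reductor (k, Gprev, G)`. -/
def IsReductor (m : MonomialOrder (Fin n)) (st : State n 𝕜) (Gprev G : Finset ℕ) (k j : ℕ) :
    Prop :=
  j ∈ G ∧ m.degree (st.poly j) ≤ m.degree (st.poly k) ∧
  (st.sig j).mul (m.degree (st.poly k) - m.degree (st.poly j)) ≠ st.sig k ∧
  ¬ isRewritable st (m.degree (st.poly k) - m.degree (st.poly j)) j ∧
  ¬ TopReducible m st Gprev ((m.degree (st.poly k) - m.degree (st.poly j)) + (st.sig j).mono)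

/-- The signature `u · sig j` of the multiple of `poly j` that cancels the head term of `poly k`. -/
def reductorSig (m : MonomialOrder (Fin n)) (st : State n 𝕜) (k j : ℕ) : Sig n :=
  (st.sig j).mul (m.degree (st.poly k) - m.degree (st.poly j))

/-- The top-reduction of `poly k` by `poly j`, made monic if it is nonzero. -/
def topReduct (m : MonomialOrder (Fin n)) (st : State n 𝕜) (k j : ℕ) : MvPolynomial (Fin n) 𝕜 :=
  monic m (st.poly k -
    monomial (m.degree (st.poly k) - m.degree (st.poly j))
      (m.leadingCoeff (st.poly k) * (m.leadingCoeff (st.poly j))⁻¹) * st.poly j)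

/-- `TopReduction m Gprev G st k st' completed todo`: called on `k` in the state `st`,
`Top_Reduction` may return `completed, todo` and leave the state `st'`. -/
inductive TopReduction (m : MonomialOrder (Fin n)) (Gprev G : Finset ℕ) (st : State n 𝕜) (k : ℕ) :
    State n 𝕜 → Finset ℕ → Finset ℕ → Prop
  | zero (hk : st.poly k = 0) : TopReduction m Gprev G st k st ∅ ∅
  | irreducible (hk : st.poly k ≠ 0) (hJ : ∀ j, ¬ IsReductor m st Gprev G k j) :
      TopReduction m Gprev G st k (st.setPoly k (monic m (st.poly k))) {k} ∅
  | safe (hk : st.poly k ≠ 0) (j : ℕ) (hj : IsReductor m st Gprev G k j)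
      (hs : (reductorSig m st k j).LT m (st.sig k)) :
      TopReduction m Gprev G st k (st.setPoly k (topReduct m st k j)) ∅ {k}
  | unsafeSig (hk : st.poly k ≠ 0) (j : ℕ) (hj : IsReductor m st Gprev G k j)
      (hs : ¬ (reductorSig m st k j).LT m (st.sig k)) :
      TopReduction m Gprev G st k
        (st.appendWithRule (reductorSig m st k j) (topReduct m st k j)) ∅ {k, st.size + 1}

/-- `ReductionLoop m B Gprev G st todo completed st' out`: the loop of `Reduction`, entered in the
state `st` with the given values of `todo` and `completed`, may stop in the state `st'` with
`completed = out`. -/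
inductive ReductionLoop (m : MonomialOrder (Fin n)) (B : Set (MvPolynomial (Fin n) 𝕜))
    (Gprev G : Finset ℕ) :
    State n 𝕜 → Finset ℕ → Finset ℕ → State n 𝕜 → Finset ℕ → Prop
  | done (st : State n 𝕜) (completed : Finset ℕ) :
      ReductionLoop m B Gprev G st ∅ completed st completed
  | step (st st₁ st₂ : State n 𝕜) (todo completed newly redo out : Finset ℕ) (k : ℕ)
      (h : MvPolynomial (Fin n) 𝕜)
      (hk : k ∈ todo) (hmin : ∀ j ∈ todo, ¬ (st.sig j).LT m (st.sig k))
      (hh : IsNormalForm m B (st.poly k) h)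
      (htop : TopReduction m Gprev (G ∪ completed) (st.setPoly k h) k st₁ newly redo)
      (hrest : ReductionLoop m B Gprev G st₁ (todo.erase k ∪ redo) (completed ∪ newly) st₂ out) :
      ReductionLoop m B Gprev G st todo completed st₂ out

/-- The body of the inner loop of `Partial_Basis`: `k` is paired with every element of the current
index set and then added to that set. -/
def addPairs (m : MonomialOrder (Fin n)) (st : State n 𝕜) (i : ℕ) (Gprev : Finset ℕ)
    (x : Set (CritPair n) × Finset ℕ) (k : ℕ) : Set (CritPair n) × Finset ℕ :=
  (x.1 ∪ ⋃ j ∈ x.2, critPair m st i Gprev k j, insert k x.2)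

/-- `PartialBasisLoop m i B Gprev st P G st' out`: the loop of `Partial_Basis`, entered in the state
`st` with critical pairs `P` and index set `G`, may stop in the state `st'` with index set `out`.
In a pass, `d` is the least degree of a critical pair, `L` lists the pairs of degree `d` by
increasing lcm, and `K` lists the indices returned by `Reduction`. -/
inductive PartialBasisLoop (m : MonomialOrder (Fin n)) (i : ℕ)
    (B : Set (MvPolynomial (Fin n) 𝕜)) (Gprev : Finset ℕ) :
    State n 𝕜 → Set (CritPair n) → Finset ℕ → State n 𝕜 → Finset ℕ → Prop
  | done (st : State n 𝕜) (G : Finset ℕ) : PartialBasisLoop m i B Gprev st ∅ G st G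
  | step (st st₁ st₂ : State n 𝕜) (P : Set (CritPair n)) (G out : Finset ℕ)
      (d : ℕ) (L : List (CritPair n)) (K : List ℕ)
      (hd : ∃ c ∈ P, c.t.degree = d) (hmin : ∀ c ∈ P, d ≤ c.t.degree)
      (hLnodup : L.Nodup) (hL : ∀ c, c ∈ L ↔ c ∈ P ∧ c.t.degree = d)
      (hLsorted : L.Pairwise (fun c c' => c.t ≼[m] c'.t))
      (hred : ReductionLoop m B Gprev G (sPols m st L).1 (sPols m st L).2 ∅ st₁ K.toFinset)
      (hKnodup : K.Nodup)
      (hrest : PartialBasisLoop m i B Gprev st₁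
        (K.foldl (addPairs m st₁ i Gprev) (P \ {c | c.t.degree = d}, G)).1
        (K.foldl (addPairs m st₁ i Gprev) (P \ {c | c.t.degree = d}, G)).2 st₂ out) :
      PartialBasisLoop m i B Gprev st P G st₂ out

/-- `Partial_Basis (i, B, Gprev)`, called in the state `st`, may terminate in the state `st'` with
output `out`. -/
def PartialBasis (m : MonomialOrder (Fin n)) (i : ℕ) (B : Set (MvPolynomial (Fin n) 𝕜))
    (Gprev : Finset ℕ) (st st' : State n 𝕜) (out : Finset ℕ) : Prop :=
  let st₀ : State n 𝕜 := { st with rules := Function.update st.rules i [] }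
  PartialBasisLoop m i B Gprev st₀ (⋃ j ∈ Gprev, critPair m st₀ i Gprev st.size j)
    (insert st.size Gprev) st' out

/-- The state in which `r` holds just `(e₁, f₁ / lc f₁)` and there are no rules. -/
def initState (m : MonomialOrder (Fin n)) (f : ℕ → MvPolynomial (Fin n) 𝕜) : State n 𝕜 where
  size := 1
  sig := fun _ => ⟨0, 1⟩
  poly := Function.update (fun _ => 0) 1 (monic m (f 1))
  rules := fun _ => []

/-- The append of `(e_i, f_i / lc f_i)` to `r` at the start of pass `i` of the main loop. -/
def appendInput (m : MonomialOrder (Fin n)) (f : ℕ → MvPolynomial (Fin n) 𝕜) (st : State n 𝕜)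
    (i : ℕ) : State n 𝕜 :=
  st.append ⟨0, i⟩ (monic m (f i))

/-- `Reaches m M f i st Gprev B`: on the input `(f₁,…,f_M)`, the main loop of F5 may reach the head
of the loop with this value of `i`, in the state `st`, with these values of `Gprev` and `B`. -/
inductive Reaches (m : MonomialOrder (Fin n)) (M : ℕ) (f : ℕ → MvPolynomial (Fin n) 𝕜) :
    ℕ → State n 𝕜 → Finset ℕ → Set (MvPolynomial (Fin n) 𝕜) → Prop
  | start : Reaches m M f 2 (initState m f) {1} {f 1}
  | next (i : ℕ) (st st' : State n 𝕜) (Gprev out : Finset ℕ) (B : Set (MvPolynomial (Fin n) 𝕜))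
      (hreach : Reaches m M f i st Gprev B) (hi : i ≤ M)
      (hrun : PartialBasis m i B Gprev (appendInput m f st i) st' out)
      (hone : ∀ k ∈ out, st'.poly k ≠ 1) :
      Reaches m M f (i + 1) st' out {p | ∃ k ∈ out, p = st'.poly k}

/-- Iteration `i` of `Partial_Basis` in a run of F5 on the input `(f₁,…,f_M)` terminates in the
state `st` with output `Gcurr`. -/
def IterationTerminates (m : MonomialOrder (Fin n)) (M : ℕ) (f : ℕ → MvPolynomial (Fin n) 𝕜)
    (i : ℕ) (st : State n 𝕜) (Gcurr : Finset ℕ) : Prop :=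
  i ≤ M ∧ ∃ (st₀ : State n 𝕜) (Gprev : Finset ℕ) (B : Set (MvPolynomial (Fin n) 𝕜)),
    Reaches m M f i st₀ Gprev B ∧ PartialBasis m i B Gprev (appendInput m f st₀ i) st Gcurr

/-! ### The conditions on the `S`-polynomials -/

/-- `h` is a `t`-representation of `p` with respect to `(poly k)_{k ∈ G}`. -/
def IsTRep (m : MonomialOrder (Fin n)) (st : State n 𝕜) (G : Finset ℕ) (t : Fin n →₀ ℕ)
    (p : MvPolynomial (Fin n) 𝕜) (h : ℕ → MvPolynomial (Fin n) 𝕜) : Prop :=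
  p = ∑ k ∈ G, h k * st.poly k ∧ ∀ k ∈ G, h k = 0 ∨ m.degree (h k * st.poly k) ≼[m] t

/-- `h` is an `S`-representation of the `S`-polynomial of `poly a` and `poly b` with respect to
`(poly k)_{k ∈ G}`. -/
def IsSRep (m : MonomialOrder (Fin n)) (st : State n 𝕜) (G : Finset ℕ) (a b : ℕ)
    (h : ℕ → MvPolynomial (Fin n) 𝕜) : Prop :=
  ∃ t : Fin n →₀ ℕ, t ≺[m] (m.degree (st.poly a) ⊔ m.degree (st.poly b)) ∧
    IsTRep m st G t (sPol m (st.poly a) (st.poly b)) h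

/-- The `S`-polynomial of `poly a` and `poly b` has a signature-preserving `S`-representation. -/
def HasSigPreservingSRep (m : MonomialOrder (Fin n)) (M : ℕ) (f : ℕ → MvPolynomial (Fin n) 𝕜)
    (st : State n 𝕜) (G : Finset ℕ) (a b : ℕ) : Prop :=
  ∃ (s : Sig n) (h : ℕ → MvPolynomial (Fin n) 𝕜),
    IsSignature m M f (sPol m (st.poly a) (st.poly b)) s ∧
    IsSRep m st G a b h ∧
    ∃ l' ∈ G, a < l' ∧ b < l' ∧ h l' ≠ 0 ∧ (st.sig l').mul (m.degree (h l')) = s ∧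
      ∀ l ∈ G, l ≠ l' → h l = 0 ∨ ((st.sig l).mul (m.degree (h l))).LT m s

/-- `u · poly k` is rewritable in the rule list `W` for the index of `sig k`: the last entry
`W_a = (μ', j)` of `W` with `μ' ∣ u · μ_k` has `j ≠ k`. -/
def RewritableInRules (st : State n 𝕜) (u : Fin n →₀ ℕ) (k : ℕ) : Prop :=
  ∃ (a j : ℕ) (μ' : Fin n →₀ ℕ), j ≠ k ∧ st.sig j = ⟨μ', (st.sig k).idx⟩ ∧
    (st.rules (st.sig k).idx)[a]? = some (μ', j) ∧ μ' ≤ u + (st.sig k).mono ∧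
    ∀ (b c : ℕ) (μ'' : Fin n →₀ ℕ), (st.rules (st.sig k).idx)[b]? = some (μ'', c) →
      μ'' ≤ u + (st.sig k).mono → b ≤ a

/-- Condition (B) for the component `u · poly k`. -/
def ConditionB (m : MonomialOrder (Fin n)) (M : ℕ) (f : ℕ → MvPolynomial (Fin n) 𝕜) (i : ℕ)
    (st : State n 𝕜) (u : Fin n →₀ ℕ) (k : ℕ) : Prop :=
  ((st.sig k).idx = i ∧
    ¬ IsMinimalSignature m M f (monomial u 1 * st.poly k) ((st.sig k).mul u)) ∨
  RewritableInRules st u k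

end Algorithm

end

end F5

/-! Let `low s` be the span of the multiples μ f_ν of signature below s; p has signature s when p is
a nonzero scalar times μ f_ν modulo `low s`. Call a multiple u·poly k bad if it lies in `low` of
u·sig k, so that a smaller signature is available, or if some rule naming an entry later than k has
a monomial dividing that of u·sig k. Otherwise it is good. Badness passes to further multiples, and
for elements of the index set it persists during the run, because their polynomials stay fixed and
rules are only added.

The algorithm leaves a bad component in every pair from its output whose components have different
signatures. If `critPair` drops the pair, a principal syzygy lowers the signature of a component
(`HasSig.mem_low_of_degree_le`). If the pair reaches `sPols`, either a component is rewritable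
already, or the rule u·sig k is recorded under a new index and makes it so (`SPolsInv.step`). The
invariant `PairInv` carries this through the loops until no pair is waiting. Hence two good
multiples with the same head monomial have the same signature (`IterationInv.not_lt_of_degree_eq`):
they are a common multiple of the two components of an S-polynomial.

The Gröbner property follows by well-founded induction on s (`IterationInv.isSigReducible`): a
nonzero p of signature s has the head monomial of a good multiple of signature at most s. If p is
not in `low s`, let k be the latest entry whose signature divides s, with cofactor u. Then u·poly k
is good and q = p − a·u·poly k lies in `low s` for some scalar a. If q is nonzero, its head is, by
induction, that of a good multiple of smaller signature. The head of p is that of u·poly k or of q;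
otherwise these two heads cancel, and good multiples of different signatures share a head monomial.
-/

open MvPolynomial
open scoped MonomialOrder

namespace F5

noncomputable section

/-! ### The order on signatures -/

section SigOrder

variable {n : ℕ} (m : MonomialOrder (Fin n))

/-- Signatures embed into a lexicographic product, whose order is the order on signatures. -/
def Sig.key (s : Sig n) : ℕ ×ₗ m.syn := toLex (s.idx, m.toSyn s.mono)

variable {m}

lemma Sig.lt_iff_key {s t : Sig n} : s.LT m t ↔ s.key m < t.key m := by
  simp [Sig.LT, Sig.key, Prod.Lex.toLex_lt_toLex]

lemma Sig.key_injective : Function.Injective (Sig.key (n := n) m) := by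
  rintro ⟨a, i⟩ ⟨b, j⟩ h
  have h' := Prod.ext_iff.1 (toLex.injective h)
  simp only [EmbeddingLike.apply_eq_iff_eq] at h'
  rw [Sig.mk.injEq]
  exact ⟨h'.2, h'.1⟩

lemma Sig.LT.trans {s t r : Sig n} (h : s.LT m t) (h' : t.LT m r) : s.LT m r :=
  lt_iff_key.2 ((lt_iff_key.1 h).trans (lt_iff_key.1 h'))

lemma Sig.LT.irrefl (s : Sig n) : ¬ s.LT m s := fun h => lt_irrefl _ (lt_iff_key.1 h)

lemma Sig.lt_trichotomy (m : MonomialOrder (Fin n)) (s t : Sig n) :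
    s.LT m t ∨ s = t ∨ t.LT m s := by
  simp only [lt_iff_key]
  rcases _root_.lt_trichotomy (s.key m) (t.key m) with h | h | h
  · exact .inl h
  · exact .inr (.inl (key_injective h))
  · exact .inr (.inr h)

lemma Sig.LT.idx_le {s t : Sig n} (h : s.LT m t) : s.idx ≤ t.idx := by
  rcases h with h | h
  · exact h.le
  · exact h.1.le

lemma Sig.mul_idx (u : Fin n →₀ ℕ) (s : Sig n) : (s.mul u).idx = s.idx := rfl

lemma Sig.mul_mul (u v : Fin n →₀ ℕ) (s : Sig n) : (s.mul u).mul v = s.mul (v + u) := by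
  simp [Sig.mul, add_assoc]

lemma Sig.LT.mul {s t : Sig n} (h : s.LT m t) (u : Fin n →₀ ℕ) : (s.mul u).LT m (t.mul u) := by
  rcases h with h | ⟨h, h'⟩
  · exact .inl h
  · exact .inr ⟨h, by simpa [Sig.mul] using h'⟩

lemma Sig.lt_of_mul {s t : Sig n} {u : Fin n →₀ ℕ} (h : (s.mul u).LT m (t.mul u)) :
    s.LT m t := by
  rcases h with h | ⟨h, h'⟩
  · exact .inl h
  · exact .inr ⟨h, by simpa [Sig.mul] using h'⟩

/-- The exponent vector 0 is the least monomial, so `⟨0, i⟩` is a threshold that sees only the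
index. It turns `low m f ⟨0, i⟩` into the ideal of f_1, …, f_{i-1}. -/
lemma Sig.lt_zero_iff {s : Sig n} {i : ℕ} : s.LT m ⟨0, i⟩ ↔ s.idx < i := by
  have : ¬ s.mono ≺[m] 0 := by simp
  exact or_iff_left fun h => this h.2

end SigOrder

/-! ### Polynomials of bounded signature -/

section Low

variable {n : ℕ} {𝕜 : Type*} [Field 𝕜] {m : MonomialOrder (Fin n)}
  {f : ℕ → MvPolynomial (Fin n) 𝕜}

/-- The combinations of the multiples `μ f_ν` with `μ e_ν ≺ s`. -/
def low (m : MonomialOrder (Fin n)) (f : ℕ → MvPolynomial (Fin n) 𝕜) (s : Sig n) :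
    Submodule 𝕜 (MvPolynomial (Fin n) 𝕜) :=
  Submodule.span 𝕜 {q | ∃ t : Sig n, 1 ≤ t.idx ∧ t.LT m s ∧ q = monomial t.mono 1 * f t.idx}

/-- `p = c μ f_ν + (terms of smaller signature)`, where `s = μ e_ν` and `c ≠ 0`. -/
def HasSig (m : MonomialOrder (Fin n)) (f : ℕ → MvPolynomial (Fin n) 𝕜)
    (p : MvPolynomial (Fin n) 𝕜) (s : Sig n) : Prop :=
  1 ≤ s.idx ∧ ∃ c : 𝕜, c ≠ 0 ∧ p - monomial s.mono c * f s.idx ∈ low m f s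

lemma monomial_eq_smul (u : Fin n →₀ ℕ) (c : 𝕜) :
    (monomial u c : MvPolynomial (Fin n) 𝕜) = c • monomial u 1 := by
  simp [smul_monomial]

lemma monomial_mul_mem_low {s t : Sig n} (ht : 1 ≤ t.idx) (h : t.LT m s) (c : 𝕜) :
    monomial t.mono c * f t.idx ∈ low m f s := by
  rw [monomial_eq_smul, smul_mul_assoc]
  exact Submodule.smul_mem _ _ (Submodule.subset_span ⟨t, ht, h, rfl⟩)

lemma low_mono {s t : Sig n} (h : ¬ t.LT m s) : low m f s ≤ low m f t := by
  refine Submodule.span_mono ?_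
  rintro q ⟨r, hr, hrs, rfl⟩
  refine ⟨r, hr, ?_, rfl⟩
  rcases Sig.lt_trichotomy m s t with h' | rfl | h'
  · exact hrs.trans h'
  · exact hrs
  · exact absurd h' h

lemma Sig.LT.low_le {s t : Sig n} (h : s.LT m t) : low m f s ≤ low m f t :=
  low_mono fun h' => Sig.LT.irrefl _ (h.trans h')

lemma monomial_mul_mem_low_mul {s : Sig n} {p : MvPolynomial (Fin n) 𝕜} (hp : p ∈ low m f s)
    (u : Fin n →₀ ℕ) (c : 𝕜) : monomial u c * p ∈ low m f (s.mul u) := by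
  induction hp using Submodule.span_induction with
  | mem q hq =>
    obtain ⟨t, ht, hts, rfl⟩ := hq
    rw [← mul_assoc, monomial_mul, mul_one]
    exact monomial_mul_mem_low (t := t.mul u) ht (hts.mul u) c
  | zero => simp
  | add x y _ _ hx hy => rw [mul_add]; exact add_mem hx hy
  | smul a x _ hx => rw [mul_smul_comm]; exact Submodule.smul_mem _ _ hx

/-- Multiplication by a monomial leaves the index alone, so below a threshold `⟨0, i⟩` the subspace
is an ideal. -/
lemma mul_mem_low_zero {i : ℕ} {p : MvPolynomial (Fin n) 𝕜} (hp : p ∈ low m f ⟨0, i⟩)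
    (h : MvPolynomial (Fin n) 𝕜) : h * p ∈ low m f ⟨0, i⟩ := by
  rw [h.as_sum, Finset.sum_mul]
  refine Submodule.sum_mem _ fun a _ => ?_
  induction hp using Submodule.span_induction with
  | mem q hq =>
    obtain ⟨t, ht, hts, rfl⟩ := hq
    rw [← mul_assoc, monomial_mul, mul_one]
    have hts' : (t.mul a).LT m ⟨0, i⟩ := Sig.lt_zero_iff.2 (Sig.lt_zero_iff.1 hts :)
    exact monomial_mul_mem_low (t := t.mul a) ht hts' _
  | zero => simp
  | add x y _ _ hx hy => rw [mul_add]; exact add_mem hx hy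
  | smul a x _ hx => rw [mul_smul_comm]; exact Submodule.smul_mem _ _ hx

lemma mul_mem_low_of_support {s : Sig n} (hs : 1 ≤ s.idx) {h : MvPolynomial (Fin n) 𝕜}
    (hh : ∀ d ∈ h.support, d ≺[m] s.mono) : h * f s.idx ∈ low m f s := by
  rw [h.as_sum, Finset.sum_mul]
  refine Submodule.sum_mem _ fun d hd => ?_
  have hlt : Sig.LT m ⟨d, s.idx⟩ s := .inr ⟨rfl, hh d hd⟩
  exact monomial_mul_mem_low (t := ⟨d, s.idx⟩) hs hlt _

lemma HasSig.mem_low {p : MvPolynomial (Fin n) 𝕜} {s t : Sig n} (h : HasSig m f p s)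
    (hst : s.LT m t) : p ∈ low m f t := by
  obtain ⟨hs, c, -, hc⟩ := h
  have := add_mem (hst.low_le hc) (monomial_mul_mem_low hs hst c)
  rwa [sub_add_cancel] at this

lemma HasSig.sub_low {p q : MvPolynomial (Fin n) 𝕜} {s : Sig n} (h : HasSig m f p s)
    (hq : q ∈ low m f s) : HasSig m f (p - q) s := by
  obtain ⟨hs, c, hc, hp⟩ := h
  refine ⟨hs, c, hc, ?_⟩
  rw [sub_right_comm]
  exact sub_mem hp hq

lemma HasSig.monomial_mul {p : MvPolynomial (Fin n) 𝕜} {s : Sig n} (h : HasSig m f p s)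
    (u : Fin n →₀ ℕ) {a : 𝕜} (ha : a ≠ 0) : HasSig m f (monomial u a * p) (s.mul u) := by
  obtain ⟨hs, c, hc, hp⟩ := h
  refine ⟨hs, a * c, mul_ne_zero ha hc, ?_⟩
  have := monomial_mul_mem_low_mul hp u a
  rwa [mul_sub, ← mul_assoc, MvPolynomial.monomial_mul] at this

lemma HasSig.C_mul {p : MvPolynomial (Fin n) 𝕜} {s : Sig n} (h : HasSig m f p s)
    {a : 𝕜} (ha : a ≠ 0) : HasSig m f (C a * p) s := by
  simpa [Sig.mul] using h.monomial_mul 0 ha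

lemma HasSig.neg {p : MvPolynomial (Fin n) 𝕜} {s : Sig n} (h : HasSig m f p s) :
    HasSig m f (-p) s := by
  simpa using h.C_mul (neg_ne_zero.2 one_ne_zero)

lemma HasSig.low_sub {p q : MvPolynomial (Fin n) 𝕜} {s : Sig n} (h : HasSig m f p s)
    (hq : q ∈ low m f s) : HasSig m f (q - p) s := by
  simpa using (h.sub_low hq).neg

lemma HasSig.monic {p : MvPolynomial (Fin n) 𝕜} {s : Sig n} (h : HasSig m f p s) :
    HasSig m f (monic m p) s := by
  by_cases hp : p = 0
  · simpa [F5.monic, hp] using h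
  · exact h.C_mul (inv_ne_zero (m.leadingCoeff_ne_zero_iff.2 hp))

/-- Two polynomials of the same signature differ, up to a scalar, by one of smaller signature. -/
lemma HasSig.exists_sub_mem_low {p q : MvPolynomial (Fin n) 𝕜} {s : Sig n} (hq : HasSig m f q s)
    {c : 𝕜} (hp : p - monomial s.mono c * f s.idx ∈ low m f s) :
    ∃ a : 𝕜, p - a • q ∈ low m f s := by
  obtain ⟨-, d, hd, hq⟩ := hq
  refine ⟨c / d, ?_⟩
  have := sub_mem hp (Submodule.smul_mem _ (c / d) hq)
  rw [smul_sub, ← smul_mul_assoc, smul_monomial, smul_eq_mul, div_mul_cancel₀ _ hd] at this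
  simpa using this

/-- A finite combination of generators has a largest one. The coefficient c may vanish, so
cancellation of the top terms needs no separate case; the final induction allows for this. -/
lemma eq_zero_or_exists_of_mem_low {p : MvPolynomial (Fin n) 𝕜} {s : Sig n}
    (hp : p ∈ low m f s) : p = 0 ∨ ∃ t : Sig n, 1 ≤ t.idx ∧ t.LT m s ∧
      ∃ c : 𝕜, p - monomial t.mono c * f t.idx ∈ low m f t := by
  induction hp using Submodule.span_induction with
  | mem q hq =>
    obtain ⟨t, ht, hts, rfl⟩ := hq
    exact .inr ⟨t, ht, hts, 1, by simp⟩
  | zero => exact .inl rfl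
  | add x y _ _ hx hy =>
    rcases hx with rfl | ⟨t, ht, hts, c, hc⟩
    · simpa using hy
    rcases hy with rfl | ⟨r, hr, hrs, d, hd⟩
    · exact .inr ⟨t, ht, hts, c, by simpa using hc⟩
    rcases Sig.lt_trichotomy m t r with h | rfl | h
    · refine .inr ⟨r, hr, hrs, d, ?_⟩
      have := add_mem (add_mem (h.low_le hc) (monomial_mul_mem_low ht h c)) hd
      rwa [sub_add_cancel, ← add_sub_assoc] at this
    · refine .inr ⟨t, ht, hts, c + d, ?_⟩
      have := add_mem hc hd
      rwa [sub_add_sub_comm, ← add_mul, ← map_add] at this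
    · refine .inr ⟨t, ht, hts, c, ?_⟩
      have := add_mem hc (add_mem (h.low_le hd) (monomial_mul_mem_low hr h d))
      rwa [sub_add_cancel, sub_add_eq_add_sub] at this
  | smul a x _ hx =>
    rcases hx with rfl | ⟨t, ht, hts, c, hc⟩
    · simp
    · refine .inr ⟨t, ht, hts, a * c, ?_⟩
      have := Submodule.smul_mem _ a hc
      rwa [smul_sub, ← smul_mul_assoc, smul_monomial, smul_eq_mul] at this

/-- A polynomial whose signature monomial is divisible by the head monomial of an element of smaller
index has a smaller signature. -/
lemma HasSig.mem_low_of_degree_le {p g : MvPolynomial (Fin n) 𝕜} {s : Sig n}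
    (h : HasSig m f p s) (hg : g ∈ low m f ⟨0, s.idx⟩) (hg0 : g ≠ 0)
    (hdeg : m.degree g ≤ s.mono) : p ∈ low m f s := by
  obtain ⟨hs, c, -, hp⟩ := h
  have hlow : low m f ⟨0, s.idx⟩ ≤ low m f s :=
    low_mono fun h' => (Sig.lt_zero_iff.1 h').false
  set w := s.mono - m.degree g with hw
  have hws : w + m.degree g = s.mono := tsub_add_cancel_of_le hdeg
  have hlc := m.leadingCoeff_ne_zero_iff.2 hg0
  set a := c / m.leadingCoeff g with ha
  -- Write g' for g without its head term. As w·lt(g) is the signature monomial, the principal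
  -- syzygy gives c μ f_ν = (w a f_ν) g − (w a g') f_ν. The first product has smaller index; the
  -- second has only monomials below μ in front of f_ν.
  have h₁ : (monomial w a * f s.idx) * g ∈ low m f s := hlow (mul_mem_low_zero hg _)
  have h₂ : (monomial w a * (g - monomial (m.degree g) (m.leadingCoeff g))) * f s.idx
      ∈ low m f s := by
    refine mul_mem_low_of_support hs fun d hd => ?_
    rw [mem_support_iff, coeff_monomial_mul'] at hd
    obtain ⟨hwd, hd⟩ := ite_ne_right_iff.1 hd
    have hd' := right_ne_zero_of_mul hd
    rw [coeff_sub, coeff_monomial] at hd'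
    have hne : d - w ≠ m.degree g := by
      intro hcon
      rw [if_pos hcon.symm, hcon] at hd'
      exact hd' (sub_self _)
    rw [if_neg (Ne.symm hne), sub_zero] at hd'
    have hle := m.le_degree (mem_support_iff.2 hd')
    rw [← hws, ← add_tsub_cancel_of_le hwd, map_add, map_add]
    exact add_lt_add_right (lt_of_le_of_ne hle fun hcon => hne (m.toSyn.injective hcon)) _
  have h₃ : monomial s.mono c * f s.idx ∈ low m f s := by
    have := sub_mem h₁ h₂
    rw [mul_sub, MvPolynomial.monomial_mul, hws, ha, div_mul_cancel₀ _ hlc] at this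
    convert this using 1
    ring
  have := add_mem hp h₃
  rwa [sub_add_cancel] at this

/-- With `mem_span_of_mem_low`, this identifies the ideal of f_1, …, f_i with a space of bounded
signature, where the induction on signatures can start. -/
lemma mem_low_of_mem_span {i : ℕ} {p : MvPolynomial (Fin n) 𝕜}
    (hp : p ∈ Ideal.span {p | ∃ j, 1 ≤ j ∧ j ≤ i ∧ p = f j}) : p ∈ low m f ⟨0, i + 1⟩ := by
  induction hp using Submodule.span_induction with
  | mem q hq =>
    obtain ⟨j, hj, hji, rfl⟩ := hq
    simpa using monomial_mul_mem_low (t := ⟨0, j⟩) (f := f) hj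
      (Sig.lt_zero_iff.2 (Nat.lt_succ_of_le hji) : Sig.LT m ⟨0, j⟩ ⟨0, i + 1⟩) 1
  | zero => simp
  | add x y _ _ hx hy => exact add_mem hx hy
  | smul a x _ hx => exact mul_mem_low_zero hx a

lemma mem_span_of_mem_low {i : ℕ} {p : MvPolynomial (Fin n) 𝕜} (hp : p ∈ low m f ⟨0, i + 1⟩) :
    p ∈ Ideal.span {p | ∃ j, 1 ≤ j ∧ j ≤ i ∧ p = f j} := by
  induction hp using Submodule.span_induction with
  | mem q hq =>
    obtain ⟨t, ht, hts, rfl⟩ := hq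
    exact Ideal.mul_mem_left _ _ (Ideal.subset_span
      ⟨t.idx, ht, Nat.le_of_lt_succ (Sig.lt_zero_iff.1 hts), rfl⟩)
  | zero => simp
  | add x y _ _ hx hy => exact add_mem hx hy
  | smul a x _ hx => rw [smul_eq_C_mul]; exact Ideal.mul_mem_left _ _ hx

lemma degree_monomial_mul {p : MvPolynomial (Fin n) 𝕜} (hp : p ≠ 0) (u : Fin n →₀ ℕ) {c : 𝕜}
    (hc : c ≠ 0) : m.degree (monomial u c * p) = u + m.degree p := by
  classical
  rw [m.degree_mul (by simpa using hc) hp, m.degree_monomial, if_neg hc]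

lemma hasSig_monic_input {j : ℕ} (hj : 1 ≤ j) :
    HasSig m f (monic m (f j)) ⟨0, j⟩ :=
  HasSig.monic ⟨hj, 1, one_ne_zero, by simp⟩

lemma monic_ne_zero {p : MvPolynomial (Fin n) 𝕜} (hp : p ≠ 0) : monic m p ≠ 0 :=
  mul_ne_zero (by simpa using hp) hp

end Low

/-! ### Valid states -/

section Valid

variable {n : ℕ} {𝕜 : Type*} [Field 𝕜] {m : MonomialOrder (Fin n)}
  {f : ℕ → MvPolynomial (Fin n) 𝕜} {i : ℕ} {st st' st'' : State n 𝕜}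

/-- The properties of the lists `r` and `Rules` that hold throughout iteration `i`. -/
structure Valid (m : MonomialOrder (Fin n)) (f : ℕ → MvPolynomial (Fin n) 𝕜) (i : ℕ)
    (st : State n 𝕜) : Prop where
  hasSig : ∀ k, 1 ≤ k → k ≤ st.size → HasSig m f (st.poly k) (st.sig k)
  idx_le : ∀ k, 1 ≤ k → k ≤ st.size → (st.sig k).idx ≤ i
  rule_mem : ∀ ν, ∀ e ∈ st.rules ν, 1 ≤ e.2 ∧ e.2 ≤ st.size ∧ st.sig e.2 = ⟨e.1, ν⟩
  sorted : ∀ ν, (st.rules ν).Pairwise fun e e' => e.2 < e'.2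
  own_rule : ∀ k, 1 ≤ k → k ≤ st.size →
    ((st.sig k).mono, k) ∈ st.rules (st.sig k).idx ∨
      ∀ j, 1 ≤ j → j ≤ st.size → (st.sig j).idx = (st.sig k).idx → k ≤ j

/-- Some rule more recent than `k` applies to `u · sig k`. -/
def HasLaterRule (st : State n 𝕜) (u : Fin n →₀ ℕ) (k : ℕ) : Prop :=
  ∃ e ∈ st.rules (st.sig k).idx, k < e.2 ∧ e.1 ≤ u + (st.sig k).mono

/-- This heredity lets the redundancy of a critical pair pass to all common multiples of its
components. -/
lemma HasLaterRule.mono_left {u v : Fin n →₀ ℕ} {k : ℕ} (h : HasLaterRule st u k) (huv : u ≤ v) :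
    HasLaterRule st v k := by
  obtain ⟨e, he, hk, hle⟩ := h
  exact ⟨e, he, hk, hle.trans (by gcongr)⟩

lemma find?_reverse_of_sorted {α : Type*} (L : List (α × ℕ)) (q : α × ℕ → Bool)
    (hL : L.Pairwise fun e e' => e.2 < e'.2) {ρ : α × ℕ} (hρ : L.reverse.find? q = some ρ) :
    ρ ∈ L ∧ q ρ ∧ ∀ e ∈ L, q e → e.2 ≤ ρ.2 := by
  obtain ⟨hq, as, bs, hab, has⟩ := List.find?_eq_some_iff_append.1 hρ
  have hL' : L.reverse.Pairwise fun e e' => e'.2 < e.2 := List.pairwise_reverse.2 hL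
  refine ⟨by rw [← List.mem_reverse, hab]; simp, hq, fun e he hqe => ?_⟩
  rw [← List.mem_reverse, hab] at he
  rw [hab, List.pairwise_append] at hL'
  rcases List.mem_append.1 he with h | h
  · simpa [hqe] using has e h
  · rcases List.mem_cons.1 h with rfl | h
    · exact le_rfl
    · exact ((List.pairwise_cons.1 hL'.2.1).1 e h).le

/-- Rules are sorted by index, so the last applicable one names the largest entry. The rule of k
itself always applies; if k has no rule, it is the first entry of its signature index and no rule
names an earlier one. Thus the last match differs from k exactly when it is later than k, a
condition that is monotone in the rule lists and in u. -/
lemma Valid.isRewritable_iff (hv : Valid m f i st) {u : Fin n →₀ ℕ} {k : ℕ} (hk : 1 ≤ k)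
    (hk' : k ≤ st.size) : isRewritable st u k ↔ HasLaterRule st u k := by
  unfold isRewritable findRewriting
  split
  case h_1 ρ hρ =>
    obtain ⟨hmem, hq, hmax⟩ := find?_reverse_of_sorted _ _ (hv.sorted _) hρ
    refine ⟨fun hne => ⟨ρ, hmem, lt_of_le_of_ne ?_ (Ne.symm hne), by simpa using hq⟩, ?_⟩
    · rcases hv.own_rule k hk hk' with h | h
      · exact hmax _ h (by simp)
      · obtain ⟨h₁, h₂, h₃⟩ := hv.rule_mem _ ρ hmem
        exact h _ h₁ h₂ (by rw [h₃])
    · rintro ⟨e, he, hke, hle⟩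
      exact (hke.trans_le (hmax e he (by simpa using hle))).ne'
  case h_2 hρ =>
    rw [List.find?_eq_none] at hρ
    refine iff_of_false (by simp) ?_
    rintro ⟨e, he, -, hle⟩
    exact hρ e (by simpa using he) (by simpa using hle)

/-- Of two distinct entries whose multiples have the same signature, one is rewritable. -/
lemma Valid.hasLaterRule_of_mul_eq (hv : Valid m f i st) {u v : Fin n →₀ ℕ} {k l : ℕ}
    (hl : 1 ≤ l) (hk : 1 ≤ k) (hl' : l ≤ st.size) (hkl : k < l)
    (h : (st.sig k).mul u = (st.sig l).mul v) : HasLaterRule st u k := by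
  obtain ⟨h₁, h₂⟩ := Sig.mk.injEq .. ▸ h
  rcases hv.own_rule l hl hl' with h' | h'
  · refine ⟨_, h₂ ▸ h', hkl, ?_⟩
    rw [h₁]
    exact le_add_self
  · exact absurd (h' k hk (hkl.le.trans hl') h₂) (not_le.2 hkl)

/-- `st'` arises from `st` by appending to the lists and changing polynomials. -/
structure Extends (st st' : State n 𝕜) : Prop where
  size_le : st.size ≤ st'.size
  sig_eq : ∀ k, k ≤ st.size → st'.sig k = st.sig k
  rules_subset : ∀ ν, st.rules ν ⊆ st'.rules ν

lemma Extends.refl (st : State n 𝕜) : Extends st st :=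
  ⟨le_rfl, fun _ _ => rfl, fun _ => List.Subset.refl _⟩

lemma Extends.trans (h : Extends st st') (h' : Extends st' st'') : Extends st st'' :=
  ⟨h.size_le.trans h'.size_le,
    fun k hk => (h'.sig_eq k (hk.trans h.size_le)).trans (h.sig_eq k hk),
    fun ν => List.Subset.trans (h.rules_subset ν) (h'.rules_subset ν)⟩

lemma HasLaterRule.extends {u : Fin n →₀ ℕ} {k : ℕ} (h : HasLaterRule st u k)
    (he : Extends st st') (hk : k ≤ st.size) : HasLaterRule st' u k := by
  obtain ⟨e, hmem, h⟩ := h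
  rw [HasLaterRule, he.sig_eq k hk]
  exact ⟨e, he.rules_subset _ hmem, h⟩

/-! ### Effect of the elementary operations on a state -/

lemma extends_setPoly (st : State n 𝕜) (k : ℕ) (p : MvPolynomial (Fin n) 𝕜) :
    Extends st (st.setPoly k p) :=
  ⟨le_rfl, fun _ _ => rfl, fun _ => List.Subset.refl _⟩

lemma setPoly_poly_of_ne {k j : ℕ} {p : MvPolynomial (Fin n) 𝕜} (h : j ≠ k) :
    (st.setPoly k p).poly j = st.poly j := by
  simp [State.setPoly, h]

lemma setPoly_poly_self {k : ℕ} {p : MvPolynomial (Fin n) 𝕜} : (st.setPoly k p).poly k = p := by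
  simp [State.setPoly]

lemma append_sig_of_le {k : ℕ} {s : Sig n} {p : MvPolynomial (Fin n) 𝕜} (h : k ≤ st.size) :
    (st.append s p).sig k = st.sig k := by
  simp [State.append, (Nat.lt_succ_of_le h).ne]

lemma append_poly_of_le {k : ℕ} {s : Sig n} {p : MvPolynomial (Fin n) 𝕜} (h : k ≤ st.size) :
    (st.append s p).poly k = st.poly k := by
  simp [State.append, (Nat.lt_succ_of_le h).ne]

lemma append_sig_last {s : Sig n} {p : MvPolynomial (Fin n) 𝕜} :
    (st.append s p).sig (st.size + 1) = s := by
  simp [State.append]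

lemma append_poly_last {s : Sig n} {p : MvPolynomial (Fin n) 𝕜} :
    (st.append s p).poly (st.size + 1) = p := by
  simp [State.append]

lemma extends_append (st : State n 𝕜) (s : Sig n) (p : MvPolynomial (Fin n) 𝕜) :
    Extends st (st.append s p) :=
  ⟨Nat.le_succ _, fun _ hk => append_sig_of_le hk, fun _ => List.Subset.refl _⟩

lemma extends_addRule (st : State n 𝕜) (s : Sig n) (j : ℕ) : Extends st (st.addRule s j) := by
  refine ⟨le_rfl, fun _ _ => rfl, fun ν e he => ?_⟩
  by_cases h : ν = s.idx
  · subst h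
    simp [State.addRule, he]
  · simpa [State.addRule, h] using he

lemma extends_appendWithRule (st : State n 𝕜) (s : Sig n) (p : MvPolynomial (Fin n) 𝕜) :
    Extends st (st.appendWithRule s p) :=
  (extends_append st s p).trans (extends_addRule _ _ _)

lemma appendWithRule_poly_of_le {k : ℕ} {s : Sig n} {p : MvPolynomial (Fin n) 𝕜}
    (h : k ≤ st.size) : (st.appendWithRule s p).poly k = st.poly k :=
  append_poly_of_le (s := s) (p := p) h

lemma appendWithRule_sig_last {s : Sig n} {p : MvPolynomial (Fin n) 𝕜} :
    (st.appendWithRule s p).sig (st.size + 1) = s :=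
  append_sig_last (p := p)

lemma appendWithRule_poly_last {s : Sig n} {p : MvPolynomial (Fin n) 𝕜} :
    (st.appendWithRule s p).poly (st.size + 1) = p :=
  append_poly_last (s := s)

lemma mem_appendWithRule_rules {s : Sig n} {p : MvPolynomial (Fin n) 𝕜} {ν : ℕ}
    {e : (Fin n →₀ ℕ) × ℕ} : e ∈ (st.appendWithRule s p).rules ν ↔
      e ∈ st.rules ν ∨ (ν = s.idx ∧ e = (s.mono, st.size + 1)) := by
  by_cases h : ν = s.idx
  · subst h
    simp [State.appendWithRule, State.addRule, State.append]
  · simp [State.appendWithRule, State.addRule, State.append, h]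

/-! ### Preservation of validity -/

lemma Valid.setPoly (hv : Valid m f i st) {k : ℕ} {p : MvPolynomial (Fin n) 𝕜}
    (hp : HasSig m f p (st.sig k)) : Valid m f i (st.setPoly k p) where
  hasSig j hj hj' := by
    by_cases h : j = k
    · subst h
      rw [setPoly_poly_self]
      exact hp
    · rw [setPoly_poly_of_ne h]
      exact hv.hasSig j hj hj'
  idx_le := hv.idx_le
  rule_mem := hv.rule_mem
  sorted := hv.sorted
  own_rule := hv.own_rule

lemma Valid.appendWithRule (hv : Valid m f i st) {s : Sig n} {p : MvPolynomial (Fin n) 𝕜}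
    (hp : HasSig m f p s) (hs : s.idx ≤ i) : Valid m f i (st.appendWithRule s p) where
  hasSig k hk hk' := by
    change HasSig m f ((st.append s p).poly k) ((st.append s p).sig k)
    rcases Nat.le_succ_iff.1 hk' with h | rfl
    · rw [append_poly_of_le h, append_sig_of_le h]
      exact hv.hasSig k hk h
    · rwa [append_poly_last, append_sig_last]
  idx_le k hk hk' := by
    change ((st.append s p).sig k).idx ≤ i
    rcases Nat.le_succ_iff.1 hk' with h | rfl
    · rw [append_sig_of_le h]
      exact hv.idx_le k hk h
    · rwa [append_sig_last]
  rule_mem ν e he := by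
    change 1 ≤ e.2 ∧ e.2 ≤ st.size + 1 ∧ (st.append s p).sig e.2 = ⟨e.1, ν⟩
    rcases mem_appendWithRule_rules.1 he with h | ⟨rfl, rfl⟩
    · obtain ⟨h₁, h₂, h₃⟩ := hv.rule_mem ν e h
      exact ⟨h₁, h₂.trans (Nat.le_succ _), by rw [append_sig_of_le h₂, h₃]⟩
    · exact ⟨Nat.le_add_left _ _, le_rfl, append_sig_last⟩
  sorted ν := by
    by_cases h : ν = s.idx
    · subst h
      simp only [State.appendWithRule, State.addRule, Function.update_self, State.append]
      refine List.pairwise_append.2 ⟨hv.sorted _, by simp, fun a ha b hb => ?_⟩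
      rw [List.mem_singleton.1 hb]
      exact Nat.lt_succ_of_le (hv.rule_mem _ a ha).2.1
    · simpa [State.appendWithRule, State.addRule, State.append, h] using hv.sorted ν
  own_rule k hk hk' := by
    rcases Nat.le_succ_iff.1 hk' with h | rfl
    · rw [(extends_appendWithRule st s p).sig_eq k h]
      refine (hv.own_rule k hk h).imp (fun h' => mem_appendWithRule_rules.2 (.inl h')) ?_
      intro h' j hj hj' hidx
      rcases Nat.le_succ_iff.1 hj' with hj' | rfl
      · rw [(extends_appendWithRule st s p).sig_eq j hj'] at hidx
        exact h' j hj hj' hidx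
      · exact hk'
    · left
      rw [Nat.succ_eq_add_one, appendWithRule_sig_last]
      exact mem_appendWithRule_rules.2 (.inr ⟨rfl, rfl⟩)

/-- Every rule names an entry of its own index. Hence clearing the rule list at the start of the
next iteration loses nothing. -/
lemma Valid.rules_eq_nil (hv : Valid m f i st) {ν : ℕ} (hν : i < ν) : st.rules ν = [] := by
  refine List.eq_nil_iff_forall_not_mem.2 fun e he => ?_
  obtain ⟨h₁, h₂, h₃⟩ := hv.rule_mem ν e he
  have := hv.idx_le _ h₁ h₂
  rw [h₃] at this
  exact absurd hν (not_lt.2 this)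

lemma Valid.append_input (hv : Valid m f i st) :
    Valid m f (i + 1) (st.append ⟨0, i + 1⟩ (monic m (f (i + 1)))) where
  hasSig k hk hk' := by
    rcases Nat.le_succ_iff.1 hk' with h | rfl
    · rw [append_poly_of_le h, append_sig_of_le h]
      exact hv.hasSig k hk h
    · rw [append_poly_last, append_sig_last]
      exact hasSig_monic_input (Nat.le_add_left _ _)
  idx_le k hk hk' := by
    rcases Nat.le_succ_iff.1 hk' with h | rfl
    · rw [append_sig_of_le h]
      exact (hv.idx_le k hk h).trans (Nat.le_succ _)
    · rw [append_sig_last]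
  rule_mem ν e he := by
    obtain ⟨h₁, h₂, h₃⟩ := hv.rule_mem ν e he
    exact ⟨h₁, h₂.trans (Nat.le_succ _), by rw [append_sig_of_le h₂, h₃]⟩
  sorted := hv.sorted
  own_rule k hk hk' := by
    rcases Nat.le_succ_iff.1 hk' with h | rfl
    · rw [append_sig_of_le h]
      refine (hv.own_rule k hk h).imp id ?_
      intro h' j hj hj' hidx
      rcases Nat.le_succ_iff.1 hj' with hj' | rfl
      · rw [append_sig_of_le hj'] at hidx
        exact h' j hj hj' hidx
      · exact hk'
    · right
      intro j hj hj' hidx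
      rcases Nat.le_succ_iff.1 hj' with hj' | rfl
      · rw [append_sig_of_le hj', append_sig_last] at hidx
        exact absurd (hv.idx_le j hj hj') (by simp [hidx])
      · exact le_rfl

end Valid

/-! ### The loops of `SPols` and `Reduction` -/

section Loops

variable {n : ℕ} {𝕜 : Type*} [Field 𝕜] {m : MonomialOrder (Fin n)}
  {f : ℕ → MvPolynomial (Fin n) 𝕜} {i : ℕ} {st st' : State n 𝕜}

/-- The critical pair of `k` and `l`, with `k` first. -/
def mkPair (m : MonomialOrder (Fin n)) (st : State n 𝕜) (k l : ℕ) : CritPair n :=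
  ⟨m.degree (st.poly k) ⊔ m.degree (st.poly l), k, ltmul m (st.poly k) (st.poly l), l,
    ltmul m (st.poly l) (st.poly k)⟩

/-- `c` is a critical pair of distinct elements of `G`, its first component having the larger
signature, of index `i`. -/
structure IsSoundPair (m : MonomialOrder (Fin n)) (i : ℕ) (st : State n 𝕜) (G : Finset ℕ)
    (c : CritPair n) : Prop where
  left_mem : c.k ∈ G
  right_mem : c.l ∈ G
  ne : c.k ≠ c.l
  eq_mkPair : c = mkPair m st c.k c.l
  not_lt : ¬ ((st.sig c.k).mul c.u).LT m ((st.sig c.l).mul c.v)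
  idx_eq : (st.sig c.k).idx = i

/-- The elements of `G` are indices of nonzero polynomials of `r`. -/
def IsIndexSet (st : State n 𝕜) (G : Finset ℕ) : Prop :=
  ∀ k ∈ G, 1 ≤ k ∧ k ≤ st.size ∧ st.poly k ≠ 0

lemma IsIndexSet.extends {G : Finset ℕ} (hG : IsIndexSet st G) (he : Extends st st')
    (hpoly : ∀ k ∈ G, st'.poly k = st.poly k) : IsIndexSet st' G := fun k hk =>
  ⟨(hG k hk).1, (hG k hk).2.1.trans he.size_le, by rw [hpoly k hk]; exact (hG k hk).2.2⟩

lemma mkPair_congr {k l : ℕ} (hk : st'.poly k = st.poly k) (hl : st'.poly l = st.poly l) :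
    mkPair m st' k l = mkPair m st k l := by
  simp [mkPair, hk, hl]

lemma IsSoundPair.extends {G : Finset ℕ} {c : CritPair n} (hc : IsSoundPair m i st G c)
    (hG : IsIndexSet st G) (he : Extends st st') (hpoly : ∀ k ∈ G, st'.poly k = st.poly k) :
    IsSoundPair m i st' G c where
  left_mem := hc.left_mem
  right_mem := hc.right_mem
  ne := hc.ne
  eq_mkPair := by
    rw [mkPair_congr (hpoly _ hc.left_mem) (hpoly _ hc.right_mem)]
    exact hc.eq_mkPair
  not_lt := by
    rw [he.sig_eq _ (hG _ hc.left_mem).2.1, he.sig_eq _ (hG _ hc.right_mem).2.1]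
    exact hc.not_lt
  idx_eq := by
    rw [he.sig_eq _ (hG _ hc.left_mem).2.1]
    exact hc.idx_eq

lemma IsSoundPair.mono {G G' : Finset ℕ} {c : CritPair n} (hc : IsSoundPair m i st G c)
    (h : G ⊆ G') : IsSoundPair m i st G' c :=
  { hc with left_mem := h hc.left_mem, right_mem := h hc.right_mem }

/-- Equal signatures of the two components would make the earlier entry rewritable. The first
component is therefore strictly larger and its top term cannot cancel, so the recorded signature is
a true one. -/
lemma IsSoundPair.hasSig_sPol {G : Finset ℕ} {c : CritPair n} (hc : IsSoundPair m i st G c)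
    (hv : Valid m f i st) (hG : IsIndexSet st G) (hk : ¬ isRewritable st c.u c.k)
    (hl : ¬ isRewritable st c.v c.l) :
    HasSig m f (sPol m (st.poly c.k) (st.poly c.l)) ((st.sig c.k).mul c.u) := by
  obtain ⟨hk₁, hk₂, hk₃⟩ := hG _ hc.left_mem
  obtain ⟨hl₁, hl₂, hl₃⟩ := hG _ hc.right_mem
  rw [hv.isRewritable_iff hk₁ hk₂] at hk
  rw [hv.isRewritable_iff hl₁ hl₂] at hl
  have hu : c.u = ltmul m (st.poly c.k) (st.poly c.l) := congrArg CritPair.u hc.eq_mkPair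
  have hvv : c.v = ltmul m (st.poly c.l) (st.poly c.k) := congrArg CritPair.v hc.eq_mkPair
  have hlt : ((st.sig c.l).mul c.v).LT m ((st.sig c.k).mul c.u) := by
    rcases Sig.lt_trichotomy m ((st.sig c.k).mul c.u) ((st.sig c.l).mul c.v) with h | h | h
    · exact absurd h hc.not_lt
    · rcases lt_or_gt_of_ne hc.ne with hlt | hlt
      · exact absurd (hv.hasLaterRule_of_mul_eq hl₁ hk₁ hl₂ hlt h) hk
      · exact absurd (hv.hasLaterRule_of_mul_eq hk₁ hl₁ hk₂ hlt h.symm) hl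
    · exact h
  rw [sPol, ← hu, ← hvv]
  exact ((hv.hasSig _ hk₁ hk₂).monomial_mul _ (m.leadingCoeff_ne_zero_iff.2 hl₃)).sub_low
    (((hv.hasSig _ hl₁ hl₂).monomial_mul _ (m.leadingCoeff_ne_zero_iff.2 hk₃)).mem_low hlt)

/-- The state `x` during a run of `SPols` that started in the state `st`. -/
structure SPolsInv (m : MonomialOrder (Fin n)) (f : ℕ → MvPolynomial (Fin n) 𝕜) (i : ℕ)
    (st : State n 𝕜) (x : State n 𝕜 × Finset ℕ) : Prop where
  valid : Valid m f i x.1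
  ext : Extends st x.1
  poly_eq : ∀ k, k ≤ st.size → x.1.poly k = st.poly k
  cover : ∀ k, st.size < k → k ≤ x.1.size → k ∈ x.2 ∨ x.1.poly k = 0
  todo : ∀ k ∈ x.2, st.size < k ∧ k ≤ x.1.size ∧ (x.1.sig k).idx = i

/-- A processed pair always ends rewritable: a component was so before, or the new rule carries
exactly the monomial of u · sig k under an index larger than k. -/
lemma SPolsInv.step {G : Finset ℕ} {x : State n 𝕜 × Finset ℕ} {c : CritPair n}
    (hx : SPolsInv m f i st x) (hG : IsIndexSet st G) (hc : IsSoundPair m i st G c) :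
    SPolsInv m f i st (sPolsStep m x c) ∧ Extends x.1 (sPolsStep m x c).1 ∧
      (HasLaterRule (sPolsStep m x c).1 c.u c.k ∨ HasLaterRule (sPolsStep m x c).1 c.v c.l) := by
  classical
  have hpoly : ∀ k ∈ G, x.1.poly k = st.poly k := fun k hk => hx.poly_eq k (hG k hk).2.1
  have hG' := hG.extends hx.ext hpoly
  have hc' := hc.extends hG hx.ext hpoly
  obtain ⟨hk₁, hk₂, -⟩ := hG' _ hc.left_mem
  obtain ⟨hl₁, hl₂, -⟩ := hG' _ hc.right_mem
  by_cases h : ¬ isRewritable x.1 c.u c.k ∧ ¬ isRewritable x.1 c.v c.l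
  · set s := sPol m (x.1.poly c.k) (x.1.poly c.l) with hs
    have heq : sPolsStep m x c = (x.1.appendWithRule ((x.1.sig c.k).mul c.u) s,
        if s ≠ 0 then insert (x.1.size + 1) x.2 else x.2) := by
      simp only [sPolsStep, if_pos h, hs]
    have hext := extends_appendWithRule x.1 ((x.1.sig c.k).mul c.u) s
    have hlast : (x.1.appendWithRule ((x.1.sig c.k).mul c.u) s).sig (x.1.size + 1) =
      (x.1.sig c.k).mul c.u := appendWithRule_sig_last
    have hlast' : (x.1.appendWithRule ((x.1.sig c.k).mul c.u) s).poly (x.1.size + 1) = s :=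
      appendWithRule_poly_last
    rw [heq]
    refine ⟨⟨?_, hx.ext.trans hext, ?_, ?_, ?_⟩, hext, .inl ?_⟩
    · exact hx.valid.appendWithRule (hc'.hasSig_sPol hx.valid hG' h.1 h.2) hc'.idx_eq.le
    · intro k hk
      exact (appendWithRule_poly_of_le (hk.trans hx.ext.size_le)).trans (hx.poly_eq k hk)
    · intro k hk hk'
      dsimp only at hk' ⊢
      rcases Nat.le_succ_iff.1 hk' with h' | rfl
      · refine (hx.cover k hk h').imp (fun h'' => ?_) fun h'' => (appendWithRule_poly_of_le h').trans h''
        split_ifs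
        · exact Finset.mem_insert_of_mem h''
        · exact h''
      · rw [hlast']
        -- A zero S-polynomial still leaves its rule behind; only its index is withheld from the
        -- reduction.
        by_cases hs0 : s = 0
        · exact .inr hs0
        · simp [hs0]
    · intro k hk
      dsimp only at hk ⊢
      have hk' : k = x.1.size + 1 ∨ k ∈ x.2 := by
        split_ifs at hk
        · exact Finset.mem_insert.1 hk
        · exact .inr hk
      rcases hk' with rfl | hk'
      · exact ⟨Nat.lt_succ_of_le hx.ext.size_le, le_rfl, by rw [hlast]; exact hc'.idx_eq⟩
      · obtain ⟨h₁, h₂, h₃⟩ := hx.todo k hk'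
        exact ⟨h₁, h₂.trans (Nat.le_succ _), by rw [hext.sig_eq k h₂]; exact h₃⟩
    · rw [HasLaterRule, hext.sig_eq _ hk₂]
      exact ⟨_, mem_appendWithRule_rules.2 (.inr ⟨rfl, rfl⟩), Nat.lt_succ_of_le hk₂, le_rfl⟩
  · have heq : sPolsStep m x c = x := by
      simp only [sPolsStep]
      rw [if_neg h]
    rw [heq, ← hx.valid.isRewritable_iff hk₁ hk₂, ← hx.valid.isRewritable_iff hl₁ hl₂]
    exact ⟨hx, Extends.refl _, by tauto⟩

lemma SPolsInv.foldl {G : Finset ℕ} (hG : IsIndexSet st G) (L : List (CritPair n))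
    (hL : ∀ c ∈ L, IsSoundPair m i st G c) {x : State n 𝕜 × Finset ℕ}
    (hx : SPolsInv m f i st x) :
    SPolsInv m f i st (L.foldl (sPolsStep m) x) ∧ Extends x.1 (L.foldl (sPolsStep m) x).1 ∧
      ∀ c ∈ L, HasLaterRule (L.foldl (sPolsStep m) x).1 c.u c.k ∨
        HasLaterRule (L.foldl (sPolsStep m) x).1 c.v c.l := by
  induction L generalizing x with
  | nil => exact ⟨hx, Extends.refl _, by simp⟩
  | cons c L ih =>
    have hc := hL c (by simp)
    obtain ⟨h₁, h₂, h₃⟩ := hx.step hG hc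
    obtain ⟨h₄, h₅, h₆⟩ := ih (fun c' hc' => hL c' (List.mem_cons_of_mem _ hc')) h₁
    refine ⟨h₄, h₂.trans h₅, fun c' hc' => ?_⟩
    rcases List.mem_cons.1 hc' with rfl | hc'
    · exact h₃.imp
        (fun h => h.extends h₅ ((hG _ hc.left_mem).2.1.trans h₁.ext.size_le))
        (fun h => h.extends h₅ ((hG _ hc.right_mem).2.1.trans h₁.ext.size_le))
    · exact h₆ c' hc'

/-- The state during a run of `Reduction`. -/
structure ReductionInv (m : MonomialOrder (Fin n)) (f : ℕ → MvPolynomial (Fin n) 𝕜) (i : ℕ)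
    (G : Finset ℕ) (st : State n 𝕜) (todo completed : Finset ℕ) : Prop where
  valid : Valid m f i st
  indexSet : IsIndexSet st G
  completedSet : IsIndexSet st completed
  completed_idx : ∀ k ∈ completed, (st.sig k).idx = i ∧ k ∉ G
  todo_mem : ∀ k ∈ todo, 1 ≤ k ∧ k ≤ st.size ∧ (st.sig k).idx = i ∧ k ∉ G ∧ k ∉ completed
  cover : ∀ k, 1 ≤ k → k ≤ st.size → k ∈ G ∨ k ∈ completed ∨ k ∈ todo ∨ st.poly k = 0

/-- Elements of B have smaller index, so every reduction step subtracts something below the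
signature. -/
lemma HasSig.of_isNormalForm {B : Set (MvPolynomial (Fin n) 𝕜)} {p h : MvPolynomial (Fin n) 𝕜}
    {s : Sig n} (hB : ∀ b ∈ B, b ∈ low m f ⟨0, s.idx⟩) (hp : HasSig m f p s)
    (hh : IsNormalForm m B p h) : HasSig m f h s := by
  have hlow : low m f ⟨0, s.idx⟩ ≤ low m f s := low_mono fun h' => (Sig.lt_zero_iff.1 h').false
  obtain ⟨hsteps, -⟩ := hh
  induction hsteps with
  | refl => exact hp
  | tail _ hstep ih =>
    obtain ⟨b, hb, -, d, -, -, rfl⟩ := hstep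
    exact ih.sub_low (hlow (mul_mem_low_zero (hB b hb) _))

lemma ReductionInv.setPoly {G todo completed : Finset ℕ} {k : ℕ} {p : MvPolynomial (Fin n) 𝕜}
    (hI : ReductionInv m f i G st todo completed) (hk : k ∈ todo)
    (hp : HasSig m f p (st.sig k)) :
    ReductionInv m f i G (st.setPoly k p) todo completed := by
  obtain ⟨-, -, -, hkG, hkC⟩ := hI.todo_mem k hk
  exact {
    valid := hI.valid.setPoly hp
    indexSet := hI.indexSet.extends (extends_setPoly _ _ _) fun j hj =>
      setPoly_poly_of_ne (ne_of_mem_of_not_mem hj hkG)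
    completedSet := hI.completedSet.extends (extends_setPoly _ _ _) fun j hj =>
      setPoly_poly_of_ne (ne_of_mem_of_not_mem hj hkC)
    completed_idx := hI.completed_idx
    todo_mem := hI.todo_mem
    cover := fun j hj hj' => by
      by_cases hjk : j = k
      · subst hjk
        exact .inr (.inr (.inl hk))
      · rw [setPoly_poly_of_ne hjk]
        exact hI.cover j hj hj' }

/-- Labels stay truthful in every case: a safe step subtracts a multiple of smaller signature, while
in an unsafe step the reductor's multiple dominates and gives the new entry its signature. Only k
and a fresh entry are touched, so polynomials indexed by G do not change. -/
lemma ReductionInv.topReduction {Gprev G todo completed newly redo : Finset ℕ} {k : ℕ}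
    (hI : ReductionInv m f i G st todo completed) (hk : k ∈ todo)
    (htop : TopReduction m Gprev (G ∪ completed) st k st' newly redo) :
    ReductionInv m f i G st' (todo.erase k ∪ redo) (completed ∪ newly) ∧ Extends st st' ∧
      ∀ j ∈ G, st'.poly j = st.poly j := by
  obtain ⟨hk₁, hk₂, hki, hkG, hkC⟩ := hI.todo_mem k hk
  have hsig := hI.valid.hasSig k hk₁ hk₂
  have herase : todo.erase k ∪ {k} = todo := by
    ext j
    by_cases h : j = k <;> simp [h, hk]
  have hreductor : ∀ j, IsReductor m st Gprev (G ∪ completed) k j →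
      1 ≤ j ∧ j ≤ st.size ∧ st.poly j ≠ 0 := fun j hj =>
    (Finset.mem_union.1 hj.1).elim (hI.indexSet j) (hI.completedSet j)
  have hG : ∀ p, ∀ j ∈ G, (st.setPoly k p).poly j = st.poly j := fun p j hj =>
    setPoly_poly_of_ne (ne_of_mem_of_not_mem hj hkG)
  rcases htop with h0 | ⟨h0, -⟩ | ⟨h0, j, hj, hs⟩ | ⟨h0, j, hj, hs⟩
  · rw [Finset.union_empty, Finset.union_empty]
    refine ⟨{ hI with
      todo_mem := fun j hj => hI.todo_mem j (Finset.mem_of_mem_erase hj)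
      cover := fun j hj hj' => ?_ }, Extends.refl _, fun _ _ => rfl⟩
    by_cases hjk : j = k
    · subst hjk
      exact .inr (.inr (.inr h0))
    · simpa [Finset.mem_erase, hjk] using hI.cover j hj hj'
  · have hI' := hI.setPoly hk hsig.monic
    rw [Finset.union_empty]
    refine ⟨{ hI' with
      completedSet := fun j hj => ?_
      completed_idx := fun j hj => ?_
      todo_mem := fun j hj => ?_
      cover := fun j hj hj' => ?_ }, extends_setPoly _ _ _, hG _⟩
    · rcases Finset.mem_union.1 hj with hj | hj
      · exact hI'.completedSet j hj
      · rw [Finset.mem_singleton.1 hj, setPoly_poly_self]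
        exact ⟨hk₁, hk₂, monic_ne_zero h0⟩
    · rcases Finset.mem_union.1 hj with hj | hj
      · exact hI'.completed_idx j hj
      · rw [Finset.mem_singleton.1 hj]
        exact ⟨hki, hkG⟩
    · obtain ⟨hne, hj⟩ := Finset.mem_erase.1 hj
      simpa [hne] using hI'.todo_mem j hj
    · by_cases hjk : j = k
      · simp [hjk]
      · simpa [Finset.mem_erase, hjk] using hI'.cover j hj hj'
  · obtain ⟨hj₁, hj₂, hj₃⟩ := hreductor j hj
    have hnew : HasSig m f (topReduct m st k j) (st.sig k) := by
      refine (hsig.sub_low (((hI.valid.hasSig j hj₁ hj₂).monomial_mul _ ?_).mem_low hs)).monic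
      exact mul_ne_zero (m.leadingCoeff_ne_zero_iff.2 h0)
        (inv_ne_zero (m.leadingCoeff_ne_zero_iff.2 hj₃))
    rw [Finset.union_empty, herase]
    exact ⟨hI.setPoly hk hnew, extends_setPoly _ _ _, hG _⟩
  · obtain ⟨hj₁, hj₂, hj₃⟩ := hreductor j hj
    -- Equality of the two signatures is excluded by the tests on a reductor.
    have hlt : (st.sig k).LT m (reductorSig m st k j) := by
      rcases Sig.lt_trichotomy m (st.sig k) (reductorSig m st k j) with h | h | h
      · exact h
      · exact absurd h.symm hj.2.2.1
      · exact absurd h hs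
    have hidx : (reductorSig m st k j).idx = i :=
      le_antisymm (hI.valid.idx_le j hj₁ hj₂) (hki ▸ hlt.idx_le)
    have hnew : HasSig m f (topReduct m st k j) (reductorSig m st k j) := by
      refine (((hI.valid.hasSig j hj₁ hj₂).monomial_mul _ ?_).low_sub (hsig.mem_low hlt)).monic
      exact mul_ne_zero (m.leadingCoeff_ne_zero_iff.2 h0)
        (inv_ne_zero (m.leadingCoeff_ne_zero_iff.2 hj₃))
    have hext := extends_appendWithRule st (reductorSig m st k j) (topReduct m st k j)
    have hpoly : ∀ l, l ≤ st.size → (st.appendWithRule (reductorSig m st k j)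
        (topReduct m st k j)).poly l = st.poly l := fun l hl => appendWithRule_poly_of_le hl
    have hlast : (st.appendWithRule (reductorSig m st k j)
        (topReduct m st k j)).sig (st.size + 1) = reductorSig m st k j := appendWithRule_sig_last
    have htodo : todo.erase k ∪ {k, st.size + 1} = insert (st.size + 1) todo := by
      ext l
      by_cases h : l = k <;> simp [h, hk, or_comm]
    rw [Finset.union_empty, htodo]
    refine ⟨{
      valid := hI.valid.appendWithRule hnew hidx.le
      indexSet := hI.indexSet.extends hext fun l hl => hpoly l (hI.indexSet l hl).2.1
      completedSet := hI.completedSet.extends hext fun l hl => hpoly l (hI.completedSet l hl).2.1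
      completed_idx := fun l hl => by
        rw [hext.sig_eq l (hI.completedSet l hl).2.1]
        exact hI.completed_idx l hl
      todo_mem := fun l hl => ?_
      cover := fun l hl hl' => ?_ }, hext, fun l hl => hpoly l (hI.indexSet l hl).2.1⟩
    · rcases Finset.mem_insert.1 hl with rfl | hl
      · refine ⟨Nat.le_add_left _ _, le_rfl, by rw [hlast, hidx], fun h => ?_, fun h => ?_⟩
        · exact absurd (hI.indexSet _ h).2.1 (by simp)
        · exact absurd (hI.completedSet _ h).2.1 (by simp)
      · obtain ⟨h₁, h₂, h₃⟩ := hI.todo_mem l hl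
        exact ⟨h₁, h₂.trans (Nat.le_succ _), by rw [hext.sig_eq l h₂]; exact h₃⟩
    · rcases Nat.le_succ_iff.1 hl' with h | rfl
      · rw [hpoly l h]
        have := hI.cover l hl h
        simp only [Finset.mem_insert]
        tauto
      · exact .inr (.inr (.inl (Finset.mem_insert_self _ _)))

lemma ReductionLoop.reductionInv {B : Set (MvPolynomial (Fin n) 𝕜)}
    {Gprev G todo completed out : Finset ℕ}
    (hB : ∀ b ∈ B, b ∈ low m f ⟨0, i⟩)
    (hloop : ReductionLoop m B Gprev G st todo completed st' out)
    (hI : ReductionInv m f i G st todo completed) :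
    ReductionInv m f i G st' ∅ out ∧ Extends st st' ∧ ∀ j ∈ G, st'.poly j = st.poly j := by
  induction hloop with
  | done st completed => exact ⟨hI, Extends.refl _, fun _ _ => rfl⟩
  | step st st₁ st₂ todo completed newly redo out k h hk hmin hh htop hrest ih =>
    obtain ⟨hk₁, hk₂, hki, hkG, -⟩ := hI.todo_mem k hk
    have hsig := HasSig.of_isNormalForm (by rwa [hki]) (hI.valid.hasSig k hk₁ hk₂) hh
    obtain ⟨h₁, h₂, h₃⟩ := (hI.setPoly hk hsig).topReduction hk htop
    obtain ⟨h₄, h₅, h₆⟩ := ih h₁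
    refine ⟨h₄, ((extends_setPoly _ _ _).trans h₂).trans h₅, fun j hj => ?_⟩
    rw [h₆ j hj, h₃ j hj, setPoly_poly_of_ne (ne_of_mem_of_not_mem hj hkG)]

end Loops

/-! ### Critical pairs -/

section Pairs

variable {n : ℕ} {𝕜 : Type*} [Field 𝕜] {m : MonomialOrder (Fin n)}
  {f : ℕ → MvPolynomial (Fin n) 𝕜} {i : ℕ} {st st' : State n 𝕜}

/-- A component of the `S`-polynomial of `poly k` and `poly l` has a signature smaller than its
natural one, or is rewritable. -/
def IsRedundantPair (m : MonomialOrder (Fin n)) (f : ℕ → MvPolynomial (Fin n) 𝕜)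
    (st : State n 𝕜) (k l : ℕ) : Prop :=
  (monomial (ltmul m (st.poly k) (st.poly l)) 1 * st.poly k ∈
      low m f ((st.sig k).mul (ltmul m (st.poly k) (st.poly l))) ∨
    HasLaterRule st (ltmul m (st.poly k) (st.poly l)) k) ∨
  (monomial (ltmul m (st.poly l) (st.poly k)) 1 * st.poly l ∈
      low m f ((st.sig l).mul (ltmul m (st.poly l) (st.poly k))) ∨
    HasLaterRule st (ltmul m (st.poly l) (st.poly k)) l)

lemma IsRedundantPair.symm {k l : ℕ} (h : IsRedundantPair m f st k l) :
    IsRedundantPair m f st l k :=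
  Or.symm h

lemma IsRedundantPair.extends {k l : ℕ} (h : IsRedundantPair m f st k l) (he : Extends st st')
    (hk : k ≤ st.size) (hl : l ≤ st.size) (hk' : st'.poly k = st.poly k)
    (hl' : st'.poly l = st.poly l) : IsRedundantPair m f st' k l := by
  rw [IsRedundantPair, hk', hl', he.sig_eq k hk, he.sig_eq l hl]
  exact h.imp (.imp_right fun h => h.extends he hk) (.imp_right fun h => h.extends he hl)

/-- The component of `k` in the pair `(k, l)` has the larger signature. -/
def Dominates (m : MonomialOrder (Fin n)) (st : State n 𝕜) (k l : ℕ) : Prop :=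
  ((st.sig l).mul (ltmul m (st.poly l) (st.poly k))).LT m
    ((st.sig k).mul (ltmul m (st.poly k) (st.poly l)))

/-- Every pair from `G` is redundant or waits in `P`, and `P` holds only critical pairs from `G`. -/
structure PairInv (m : MonomialOrder (Fin n)) (f : ℕ → MvPolynomial (Fin n) 𝕜) (i : ℕ)
    (st : State n 𝕜) (P : Set (CritPair n)) (G : Finset ℕ) : Prop where
  indexSet : IsIndexSet st G
  redundant : ∀ k ∈ G, ∀ l ∈ G, k ≠ l → Dominates m st k l →
    IsRedundantPair m f st k l ∨ mkPair m st k l ∈ P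
  sound : ∀ c ∈ P, IsSoundPair m i st G c

/-- A pair may leave the waiting set only once a component has become rewritable, which is the
content of `hrew`. -/
lemma PairInv.extends {P P' : Set (CritPair n)} {G : Finset ℕ} (h : PairInv m f i st P G)
    (he : Extends st st') (hpoly : ∀ k ∈ G, st'.poly k = st.poly k) (hP : P' ⊆ P)
    (hrew : ∀ c ∈ P, c ∉ P' → HasLaterRule st' c.u c.k ∨ HasLaterRule st' c.v c.l) :
    PairInv m f i st' P' G where
  indexSet := h.indexSet.extends he hpoly
  redundant k hk l hl hkl hdom := by
    have hk' := (h.indexSet k hk).2.1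
    have hl' := (h.indexSet l hl).2.1
    rw [Dominates, hpoly k hk, hpoly l hl, he.sig_eq k hk', he.sig_eq l hl'] at hdom
    rw [mkPair_congr (hpoly k hk) (hpoly l hl)]
    rcases h.redundant k hk l hl hkl hdom with h' | h'
    · exact .inl (h'.extends he hk' hl' (hpoly k hk) (hpoly l hl))
    · by_cases hmem : mkPair m st k l ∈ P'
      · exact .inr hmem
      · left
        rw [IsRedundantPair, hpoly k hk, hpoly l hl]
        exact (hrew _ h' hmem).imp .inr .inr
  sound c hc := (h.sound c (hP hc)).extends h.indexSet he hpoly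

lemma critPair_cases (m : MonomialOrder (Fin n)) (st : State n 𝕜) (i : ℕ) (Gprev : Finset ℕ)
    (k l : ℕ) :
    (critPair m st i Gprev k l = ∅ ∧
      (((st.sig k).idx = i ∧
        TopReducible m st Gprev (ltmul m (st.poly k) (st.poly l) + (st.sig k).mono)) ∨
      ((st.sig l).idx = i ∧
        TopReducible m st Gprev (ltmul m (st.poly l) (st.poly k) + (st.sig l).mono)))) ∨
    (Dominates m st l k ∧ critPair m st i Gprev k l = {mkPair m st l k}) ∨
    (¬ Dominates m st l k ∧ critPair m st i Gprev k l = {mkPair m st k l}) := by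
  have hu : m.degree (st.poly k) ⊔ m.degree (st.poly l) - m.degree (st.poly k) =
    ltmul m (st.poly k) (st.poly l) := rfl
  have hv : m.degree (st.poly k) ⊔ m.degree (st.poly l) - m.degree (st.poly l) =
    ltmul m (st.poly l) (st.poly k) := by rw [ltmul, sup_comm]
  have hlk : mkPair m st l k = ⟨m.degree (st.poly k) ⊔ m.degree (st.poly l), l,
    ltmul m (st.poly l) (st.poly k), k, ltmul m (st.poly k) (st.poly l)⟩ := by
    rw [mkPair, sup_comm]
  simp only [critPair, hlk, Dominates]
  split_ifs with h₁ h₂ h₃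
  · exact .inl ⟨rfl, .inl h₁⟩
  · exact .inl ⟨rfl, .inr (hv ▸ h₂)⟩
  · exact .inr (.inl ⟨hv ▸ h₃, by rw [hv, hu]⟩)
  · exact .inr (.inr ⟨hv ▸ h₃, by rw [hv, hu]; rfl⟩)

/-- The elements of `Gprev` are nonzero polynomials of index less than `i`. -/
def IsPrevSet (m : MonomialOrder (Fin n)) (f : ℕ → MvPolynomial (Fin n) 𝕜) (i : ℕ)
    (st : State n 𝕜) (Gprev : Finset ℕ) : Prop :=
  ∀ j ∈ Gprev, st.poly j ≠ 0 ∧ st.poly j ∈ low m f ⟨0, i⟩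

lemma IsPrevSet.congr {Gprev : Finset ℕ} (h : IsPrevSet m f i st Gprev)
    (hpoly : ∀ j ∈ Gprev, st'.poly j = st.poly j) : IsPrevSet m f i st' Gprev := fun j hj => by
  rw [hpoly j hj]
  exact h j hj

/-- This justifies the criterion that drops critical pairs: divisibility by a head monomial of
smaller index yields a principal syzygy, so the natural signature is not minimal. -/
lemma IsPrevSet.mem_low {Gprev : Finset ℕ} (hprev : IsPrevSet m f i st Gprev)
    (hv : Valid m f i st) {k : ℕ} (hk : 1 ≤ k) (hk' : k ≤ st.size) (hi : (st.sig k).idx = i)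
    {u : Fin n →₀ ℕ} (htop : TopReducible m st Gprev (u + (st.sig k).mono)) :
    monomial u 1 * st.poly k ∈ low m f ((st.sig k).mul u) := by
  obtain ⟨j, hj, hle⟩ := htop
  obtain ⟨hj0, hjlow⟩ := hprev j hj
  refine ((hv.hasSig k hk hk').monomial_mul u one_ne_zero).mem_low_of_degree_le ?_ hj0 hle
  rwa [Sig.mul_idx, hi]

lemma IsPrevSet.redundant_or_mem {Gprev : Finset ℕ} (hprev : IsPrevSet m f i st Gprev)
    (hv : Valid m f i st) {k l : ℕ} (hk : 1 ≤ k) (hk' : k ≤ st.size) (hl : 1 ≤ l)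
    (hl' : l ≤ st.size) :
    IsRedundantPair m f st k l ∨
      (Dominates m st l k → mkPair m st l k ∈ critPair m st i Gprev k l) ∧
      (Dominates m st k l → mkPair m st k l ∈ critPair m st i Gprev k l) := by
  rcases critPair_cases m st i Gprev k l with ⟨-, h | h⟩ | ⟨h, h'⟩ | ⟨h, h'⟩
  · exact .inl (.inl (.inl (hprev.mem_low hv hk hk' h.1 h.2)))
  · exact .inl (.inr (.inl (hprev.mem_low hv hl hl' h.1 h.2)))
  · exact .inr ⟨fun _ => by simp [h'], fun h'' => absurd (h.trans h'') (Sig.LT.irrefl _)⟩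
  · exact .inr ⟨fun h'' => absurd h'' h, fun _ => by simp [h']⟩

lemma isSoundPair_of_mem_critPair (hv : Valid m f i st) {Gprev G : Finset ℕ}
    {k l : ℕ} (hkG : k ∈ G) (hlG : l ∈ G) (hkl : k ≠ l)
    (hl : 1 ≤ l) (hl' : l ≤ st.size) (hi : (st.sig k).idx = i) {c : CritPair n}
    (hc : c ∈ critPair m st i Gprev k l) : IsSoundPair m i st G c := by
  rcases critPair_cases m st i Gprev k l with ⟨h, -⟩ | ⟨h, h'⟩ | ⟨h, h'⟩
  · simp [h] at hc
  · rw [h', Set.mem_singleton_iff] at hc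
    subst hc
    exact ⟨hlG, hkG, hkl.symm, rfl, fun h'' => Sig.LT.irrefl _ (h.trans h''),
      le_antisymm (hv.idx_le l hl hl') (hi ▸ h.idx_le)⟩
  · rw [h', Set.mem_singleton_iff] at hc
    subst hc
    exact ⟨hkG, hlG, hkl, rfl, h, hi⟩

/-- Only pairs involving k are new, and each is either dropped for a smaller signature or placed
among the waiting pairs. -/
lemma PairInv.insert {P : Set (CritPair n)} {Gprev G : Finset ℕ} (h : PairInv m f i st P G)
    (hprev : IsPrevSet m f i st Gprev) (hv : Valid m f i st) {k : ℕ} (hkG : k ∉ G) (hk : 1 ≤ k)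
    (hk' : k ≤ st.size) (hk0 : st.poly k ≠ 0) (hi : (st.sig k).idx = i) :
    PairInv m f i st (P ∪ ⋃ j ∈ G, critPair m st i Gprev k j) (insert k G) where
  indexSet j hj := by
    rcases Finset.mem_insert.1 hj with rfl | hj
    · exact ⟨hk, hk', hk0⟩
    · exact h.indexSet j hj
  redundant a ha b hb hab hdom := by
    have hnew : ∀ l ∈ G, ∀ c, c ∈ critPair m st i Gprev k l →
        c ∈ P ∪ ⋃ j ∈ G, critPair m st i Gprev k j := fun l hl c hc =>
      .inr (Set.mem_biUnion (x := l) hl hc)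
    rcases Finset.mem_insert.1 ha with rfl | ha' <;> rcases Finset.mem_insert.1 hb with rfl | hb'
    · exact absurd rfl hab
    · obtain ⟨h₁, h₂, -⟩ := h.indexSet b hb'
      exact (hprev.redundant_or_mem hv hk hk' h₁ h₂).imp_right fun h' => hnew b hb' _ (h'.2 hdom)
    · obtain ⟨h₁, h₂, -⟩ := h.indexSet a ha'
      exact (hprev.redundant_or_mem hv hk hk' h₁ h₂).imp .symm fun h' => hnew a ha' _ (h'.1 hdom)
    · exact (h.redundant a ha' b hb' hab hdom).imp_right .inl
  sound c hc := by
    rcases hc with hc | hc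
    · exact (h.sound c hc).mono (Finset.subset_insert _ _)
    · obtain ⟨l, hl, hc⟩ := Set.mem_iUnion₂.1 hc
      obtain ⟨h₁, h₂, -⟩ := h.indexSet l hl
      exact isSoundPair_of_mem_critPair hv (Finset.mem_insert_self _ _)
        (Finset.mem_insert_of_mem hl) (ne_of_mem_of_not_mem hl hkG).symm h₁ h₂ hi hc

lemma PairInv.foldl_addPairs {P : Set (CritPair n)} {Gprev G : Finset ℕ}
    (h : PairInv m f i st P G) (hprev : IsPrevSet m f i st Gprev) (hv : Valid m f i st)
    (K : List ℕ) (hK : K.Nodup) (hKG : ∀ k ∈ K, k ∉ G ∧ 1 ≤ k ∧ k ≤ st.size ∧ st.poly k ≠ 0 ∧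
      (st.sig k).idx = i) :
    PairInv m f i st (K.foldl (addPairs m st i Gprev) (P, G)).1
        (K.foldl (addPairs m st i Gprev) (P, G)).2 ∧
      ∀ j, j ∈ (K.foldl (addPairs m st i Gprev) (P, G)).2 ↔ j ∈ G ∨ j ∈ K := by
  induction K generalizing P G with
  | nil => simpa using h
  | cons k K ih =>
    obtain ⟨hkK, hK⟩ := List.nodup_cons.1 hK
    obtain ⟨h₁, h₂, h₃, h₄, h₅⟩ := hKG k (by simp)
    obtain ⟨h₆, h₇⟩ := ih (h.insert hprev hv h₁ h₂ h₃ h₄ h₅) hK fun j hj => by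
      obtain ⟨h', h''⟩ := hKG j (List.mem_cons_of_mem _ hj)
      exact ⟨by simp [h', ne_of_mem_of_not_mem hj hkK], h''⟩
    refine ⟨h₆, fun j => (h₇ j).trans ?_⟩
    rw [Finset.mem_insert, List.mem_cons]
    tauto

end Pairs

/-! ### The main loop -/

section MainLoop

variable {n : ℕ} {𝕜 : Type*} [Field 𝕜] {m : MonomialOrder (Fin n)}
  {f : ℕ → MvPolynomial (Fin n) 𝕜} {i : ℕ} {st st' : State n 𝕜}

/-- In one pass, `sPols` makes all pairs of least degree rewritable and the reduction leaves
polynomials indexed by G unchanged, so these pairs may be removed. The covering clause records that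
every labeled polynomial enters the index set or becomes zero. -/
lemma PartialBasisLoop.pairInv {B : Set (MvPolynomial (Fin n) 𝕜)} {Gprev G out : Finset ℕ}
    {P : Set (CritPair n)} (hB : ∀ b ∈ B, b ∈ low m f ⟨0, i⟩)
    (hloop : PartialBasisLoop m i B Gprev st P G st' out) (hGprev : Gprev ⊆ G)
    (hprev : IsPrevSet m f i st Gprev) (hv : Valid m f i st) (hP : PairInv m f i st P G)
    (hcover : ∀ k, 1 ≤ k → k ≤ st.size → k ∈ G ∨ st.poly k = 0) :
    Valid m f i st' ∧ PairInv m f i st' ∅ out ∧ Extends st st' ∧ G ⊆ out ∧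
      (∀ k ∈ G, st'.poly k = st.poly k) ∧
      ∀ k, 1 ≤ k → k ≤ st'.size → k ∈ out ∨ st'.poly k = 0 := by
  induction hloop with
  | done st G =>
    exact ⟨hv, hP, Extends.refl _, Finset.Subset.refl _, fun _ _ => rfl, hcover⟩
  | step st st₁ st₂ P G out d L K hd hmin hLnodup hL hLsorted hred hKnodup hrest ih =>
    have hx : SPolsInv m f i st (st, ∅) :=
      ⟨hv, Extends.refl _, fun _ _ => rfl, fun k h h' => absurd h' (not_le.2 h), by simp⟩
    obtain ⟨h₁, h₂, h₃⟩ := SPolsInv.foldl hP.indexSet L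
      (fun c hc => hP.sound c ((hL c).1 hc).1) hx
    change SPolsInv m f i st (sPols m st L) at h₁
    change Extends st (sPols m st L).1 at h₂
    change ∀ c ∈ L, HasLaterRule (sPols m st L).1 c.u c.k ∨
      HasLaterRule (sPols m st L).1 c.v c.l at h₃
    have hpoly₁ : ∀ k ∈ G, (sPols m st L).1.poly k = st.poly k := fun k hk =>
      h₁.poly_eq k (hP.indexSet k hk).2.1
    have hI : ReductionInv m f i G (sPols m st L).1 (sPols m st L).2 ∅ := {
      valid := h₁.valid
      indexSet := hP.indexSet.extends h₂ hpoly₁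
      completedSet := by simp [IsIndexSet]
      completed_idx := by simp
      todo_mem := fun k hk => by
        obtain ⟨h, h', h''⟩ := h₁.todo k hk
        exact ⟨Nat.one_le_of_lt h, h', h'',
          fun hkG => absurd (hP.indexSet k hkG).2.1 (not_le.2 h), by simp⟩
      cover := fun k hk hk' => by
        rcases le_or_gt k st.size with h | h
        · rw [h₁.poly_eq k h]
          exact (hcover k hk h).imp_right fun h => .inr (.inr h)
        · exact .inr (.inr (h₁.cover k h hk')) }
    obtain ⟨h₄, h₅, h₆⟩ := hred.reductionInv hB hI
    have hpoly₂ : ∀ k ∈ G, st₁.poly k = st.poly k := fun k hk => (h₆ k hk).trans (hpoly₁ k hk)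
    have hext := h₂.trans h₅
    have hprev' : IsPrevSet m f i st₁ Gprev := hprev.congr fun j hj => hpoly₂ j (hGprev hj)
    have hP' : PairInv m f i st₁ (P \ {c | c.t.degree = d}) G := by
      refine hP.extends hext hpoly₂ Set.sdiff_subset fun c hc hc' => ?_
      have hcd : c.t.degree = d := by
        by_contra hne
        exact hc' ⟨hc, hne⟩
      have hs := hP.sound c hc
      exact (h₃ c ((hL c).2 ⟨hc, hcd⟩)).imp
        (fun h => h.extends h₅ ((hP.indexSet _ hs.left_mem).2.1.trans h₂.size_le))
        (fun h => h.extends h₅ ((hP.indexSet _ hs.right_mem).2.1.trans h₂.size_le))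
    obtain ⟨h₇, h₈⟩ := hP'.foldl_addPairs hprev' h₄.valid K hKnodup fun k hk => by
      have hk' := List.mem_toFinset.2 hk
      obtain ⟨h, h', h''⟩ := h₄.completedSet k hk'
      exact ⟨(h₄.completed_idx k hk').2, h, h', h'', (h₄.completed_idx k hk').1⟩
    have hsub : G ⊆ (K.foldl (addPairs m st₁ i Gprev) (P \ {c | c.t.degree = d}, G)).2 :=
      fun j hj => (h₈ j).2 (.inl hj)
    obtain ⟨h₉, h₁₀, h₁₁, h₁₂, h₁₃, h₁₄⟩ := ih (hGprev.trans hsub) hprev' h₄.valid h₇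
      fun k hk hk' => by
        rw [h₈]
        have := h₄.cover k hk hk'
        simp only [List.mem_toFinset, Finset.notMem_empty, false_or] at this
        tauto
    exact ⟨h₉, h₁₀, hext.trans h₁₁, hsub.trans h₁₂,
      fun k hk => (h₁₃ k (hsub hk)).trans (hpoly₂ k hk), h₁₄⟩

/-- The state at the end of iteration `i`, with output `G`. -/
structure IterationInv (m : MonomialOrder (Fin n)) (f : ℕ → MvPolynomial (Fin n) 𝕜) (i : ℕ)
    (st : State n 𝕜) (G : Finset ℕ) : Prop where
  valid : Valid m f i st
  indexSet : IsIndexSet st G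
  redundant : ∀ k ∈ G, ∀ l ∈ G, k ≠ l → Dominates m st k l → IsRedundantPair m f st k l
  cover : ∀ k, 1 ≤ k → k ≤ st.size → k ∈ G ∨ st.poly k = 0
  input : ∀ ν, 1 ≤ ν → ν ≤ i → ∃ k ∈ G, st.sig k = ⟨0, ν⟩ ∧ st.poly k = monic m (f ν)

lemma IterationInv.poly_mem_low {G : Finset ℕ} (h : IterationInv m f i st G) {k : ℕ}
    (hk : k ∈ G) : st.poly k ∈ low m f ⟨0, i + 1⟩ := by
  obtain ⟨h₁, h₂, -⟩ := h.indexSet k hk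
  exact (h.valid.hasSig k h₁ h₂).mem_low
    (Sig.lt_zero_iff.2 (Nat.lt_succ_of_le (h.valid.idx_le k h₁ h₂)))

lemma IterationInv.partialBasis {B : Set (MvPolynomial (Fin n) 𝕜)} {Gprev out : Finset ℕ}
    (h : IterationInv m f i st Gprev) (hB : ∀ b ∈ B, b ∈ low m f ⟨0, i + 1⟩)
    (hf : f (i + 1) ≠ 0)
    (hrun : PartialBasis m (i + 1) B Gprev (appendInput m f st (i + 1)) st' out) :
    IterationInv m f (i + 1) st' out := by
  set st₁ := appendInput m f st (i + 1) with hst₁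
  have hrules : Function.update st₁.rules (i + 1) [] = st₁.rules := by
    rw [← h.valid.rules_eq_nil (Nat.lt_succ_self i)]
    exact Function.update_eq_self _ _
  have hsize : st₁.size = st.size + 1 := rfl
  have hv : Valid m f (i + 1) st₁ := h.valid.append_input
  have hext : Extends st st₁ := extends_append _ _ _
  have hpoly : ∀ k, k ≤ st.size → st₁.poly k = st.poly k := fun k hk => append_poly_of_le hk
  have hpolyG : ∀ k ∈ Gprev, st₁.poly k = st.poly k := fun k hk =>
    hpoly k (h.indexSet k hk).2.1
  have hlast : st₁.poly (st.size + 1) = monic m (f (i + 1)) := append_poly_last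
  have hlast' : st₁.sig (st.size + 1) = ⟨0, i + 1⟩ := append_sig_last
  have hprev : IsPrevSet m f (i + 1) st₁ Gprev := fun j hj => by
    rw [hpolyG j hj]
    exact ⟨(h.indexSet j hj).2.2, h.poly_mem_low hj⟩
  have hP : PairInv m f (i + 1) st ∅ Gprev :=
    ⟨h.indexSet, fun k hk l hl hkl hd => .inl (h.redundant k hk l hl hkl hd), by simp⟩
  have hP' : PairInv m f (i + 1) st₁
      (∅ ∪ ⋃ j ∈ Gprev, critPair m st₁ (i + 1) Gprev (st.size + 1) j)
      (insert (st.size + 1) Gprev) :=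
    (hP.extends hext hpolyG (Set.Subset.refl _) (by simp)).insert hprev hv
      (fun hmem => absurd (h.indexSet _ hmem).2.1 (by simp)) (Nat.le_add_left _ _) le_rfl
      (by rw [hlast]; exact monic_ne_zero hf) (by rw [hlast'])
  rw [Set.empty_union] at hP'
  unfold PartialBasis at hrun
  simp only [hrules] at hrun
  obtain ⟨h₁, h₂, h₃, h₄, h₅, h₆⟩ := PartialBasisLoop.pairInv hB hrun
    (Finset.subset_insert _ _) hprev hv hP' fun k hk hk' => by
      rcases Nat.le_succ_iff.1 hk' with hle | rfl
      · exact (h.cover k hk hle).imp (fun h' => Finset.mem_insert_of_mem h')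
          fun h' => (hpoly k hle).trans h'
      · exact .inl (Finset.mem_insert_self _ _)
  refine ⟨h₁, h₂.indexSet, fun k hk l hl hkl hd => ?_, h₆, fun ν hν hν' => ?_⟩
  · exact (h₂.redundant k hk l hl hkl hd).resolve_right (Set.notMem_empty _)
  · rcases Nat.le_succ_iff.1 hν' with hle | rfl
    · obtain ⟨k, hk, hks, hkp⟩ := h.input ν hν hle
      have hk' := (h.indexSet k hk).2.1
      refine ⟨k, h₄ (Finset.mem_insert_of_mem hk), ?_, ?_⟩
      · rw [h₃.sig_eq k (hk'.trans (Nat.le_succ _)), hext.sig_eq k hk', hks]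
      · exact (h₅ k (Finset.mem_insert_of_mem hk)).trans ((hpolyG k hk).trans hkp)
    · refine ⟨st.size + 1, h₄ (Finset.mem_insert_self _ _), ?_, ?_⟩
      · exact (h₃.sig_eq _ le_rfl).trans hlast'
      · exact (h₅ _ (Finset.mem_insert_self _ _)).trans hlast

lemma iterationInv_initState (hf : f 1 ≠ 0) : IterationInv m f 1 (initState m f) {1} where
  valid := {
    hasSig := fun k hk hk' => by
      obtain rfl : k = 1 := le_antisymm hk' hk
      simpa [initState] using hasSig_monic_input (m := m) (f := f) le_rfl
    idx_le := fun _ _ _ => le_rfl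
    rule_mem := by simp [initState]
    sorted := by simp [initState]
    -- There is one entry and no rule, so this entry is the first of its index.
    own_rule := fun k hk hk' => .inr fun j hj _ _ => (hk'.trans hj :) }
  indexSet := by simp [IsIndexSet, initState, monic_ne_zero hf]
  redundant k hk l hl hkl := by
    rw [Finset.mem_singleton] at hk hl
    exact absurd (hk.trans hl.symm) hkl
  cover k hk hk' := .inl (Finset.mem_singleton.2 (le_antisymm hk' hk))
  input ν hν hν' := by
    obtain rfl : ν = 1 := le_antisymm hν' hν
    exact ⟨1, by simp, rfl, by simp [initState]⟩

/-- At the head of the loop with value i, it is iteration i − 1 that is complete; hence the shift to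
j. -/
lemma Reaches.iterationInv {M : ℕ} (hf : ∀ j, 1 ≤ j → j ≤ M → f j ≠ 0) (hM : 1 ≤ M)
    {G : Finset ℕ} {B : Set (MvPolynomial (Fin n) 𝕜)} (h : Reaches m M f i st G B) :
    ∃ j, i = j + 1 ∧ IterationInv m f j st G ∧ ∀ b ∈ B, b ∈ low m f ⟨0, j + 1⟩ := by
  induction h with
  | start =>
    refine ⟨1, rfl, iterationInv_initState (hf 1 le_rfl hM), ?_⟩
    rintro b rfl
    exact mem_low_of_mem_span (Ideal.subset_span ⟨1, le_rfl, le_rfl, rfl⟩)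
  | next i st st' Gprev out B hreach hi hrun hone ih =>
    obtain ⟨j, rfl, hI, hB⟩ := ih
    have hI' := hI.partialBasis hB (hf _ (Nat.le_add_left _ _) hi) hrun
    refine ⟨j + 1, rfl, hI', ?_⟩
    rintro b ⟨k, hk, rfl⟩
    exact hI'.poly_mem_low hk

lemma IterationTerminates.iterationInv {M : ℕ} (hf : ∀ j, 1 ≤ j → j ≤ M → f j ≠ 0)
    {G : Finset ℕ} (h : IterationTerminates m M f i st G) : IterationInv m f i st G := by
  obtain ⟨hi, st₀, Gprev, B, hreach, hrun⟩ := h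
  have hM : 1 ≤ M := by
    refine le_trans ?_ hi
    cases hreach <;> exact Nat.le_add_left _ _
  obtain ⟨j, rfl, hI, hB⟩ := hreach.iterationInv hf hM
  exact hI.partialBasis hB (hf _ (Nat.le_add_left _ _) hi) hrun

end MainLoop

/-! ### The Gröbner basis property -/

section Groebner

variable {n : ℕ} {𝕜 : Type*} [Field 𝕜] {m : MonomialOrder (Fin n)}
  {f : ℕ → MvPolynomial (Fin n) 𝕜} {i : ℕ} {st : State n 𝕜} {G : Finset ℕ}

/-- The head monomial of `p` is that of a multiple `u · poly k` of signature at most `s`, which is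
neither rewritable nor has a signature smaller than `u · sig k`. -/
def IsSigReducible (m : MonomialOrder (Fin n)) (f : ℕ → MvPolynomial (Fin n) 𝕜)
    (st : State n 𝕜) (G : Finset ℕ) (s : Sig n) (p : MvPolynomial (Fin n) 𝕜) : Prop :=
  ∃ k ∈ G, ∃ u : Fin n →₀ ℕ, u + m.degree (st.poly k) = m.degree p ∧
    ¬ s.LT m ((st.sig k).mul u) ∧ ¬ HasLaterRule st u k ∧
    monomial u 1 * st.poly k ∉ low m f ((st.sig k).mul u)

lemma IsSigReducible.mono {s t : Sig n} {p : MvPolynomial (Fin n) 𝕜}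
    (h : IsSigReducible m f st G s p) (hst : s.LT m t) : IsSigReducible m f st G t p := by
  obtain ⟨k, hk, u, h₁, h₂, h₃⟩ := h
  exact ⟨k, hk, u, h₁, fun h => h₂ (hst.trans h), h₃⟩

/-- The most recent entry whose signature divides `s`. -/
lemma IterationInv.exists_rewriter (h : IterationInv m f i st G) {s : Sig n} (hs : 1 ≤ s.idx)
    (hs' : s.idx ≤ i) : ∃ k u, 1 ≤ k ∧ k ≤ st.size ∧ (st.sig k).mul u = s ∧
      ¬ HasLaterRule st u k := by
  classical
  set S := (Finset.Icc 1 st.size).filter fun k =>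
    (st.sig k).idx = s.idx ∧ (st.sig k).mono ≤ s.mono with hS
  -- The entry of the input f_ν has signature e_ν, which divides every signature of index ν.
  have hne : S.Nonempty := by
    obtain ⟨k, hk, hsig, -⟩ := h.input s.idx hs hs'
    obtain ⟨h₁, h₂, -⟩ := h.indexSet k hk
    exact ⟨k, by simp [hS, h₁, h₂, hsig]⟩
  obtain ⟨k, hkS, hmax⟩ := S.exists_max_image id hne
  simp only [hS, Finset.mem_filter, Finset.mem_Icc, id] at hkS hmax
  obtain ⟨⟨h₁, h₂⟩, h₃, h₄⟩ := hkS
  have hu : s.mono - (st.sig k).mono + (st.sig k).mono = s.mono := tsub_add_cancel_of_le h₄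
  refine ⟨k, s.mono - (st.sig k).mono, h₁, h₂, by rw [Sig.mul, hu, h₃], ?_⟩
  rintro ⟨e, he, hke, hle⟩
  obtain ⟨h₅, h₆, h₇⟩ := h.valid.rule_mem _ e he
  rw [hu] at hle
  exact absurd (hmax e.2 ⟨⟨h₅, h₆⟩, by rw [h₇]; exact ⟨h₃, hle⟩⟩) (not_le.2 hke)

/-- Two multiples with the same head monomial that are neither rewritable nor of smaller signature
have the same signature. -/
lemma IterationInv.not_lt_of_degree_eq (h : IterationInv m f i st G) {k l : ℕ} (hk : k ∈ G)
    (hl : l ∈ G) {u v : Fin n →₀ ℕ}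
    (hdeg : v + m.degree (st.poly l) = u + m.degree (st.poly k))
    (hku : ¬ HasLaterRule st u k) (hku' : monomial u 1 * st.poly k ∉ low m f ((st.sig k).mul u))
    (hlv : ¬ HasLaterRule st v l) (hlv' : monomial v 1 * st.poly l ∉ low m f ((st.sig l).mul v)) :
    ¬ ((st.sig l).mul v).LT m ((st.sig k).mul u) := by
  intro hlt
  have hkl : k ≠ l := by
    rintro rfl
    rw [add_right_cancel hdeg] at hlt
    exact Sig.LT.irrefl _ hlt
  -- The shared head monomial is a common multiple of both heads, so both products are the same
  -- multiple w of the two components of the S-polynomial.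
  have hsup : m.degree (st.poly k) ⊔ m.degree (st.poly l) ≤ u + m.degree (st.poly k) :=
    sup_le le_add_self (hdeg ▸ le_add_self)
  obtain ⟨w, hw⟩ := exists_add_of_le hsup
  have hu : u = w + ltmul m (st.poly k) (st.poly l) := by
    refine add_right_cancel (b := m.degree (st.poly k)) ?_
    rw [hw, add_assoc, ltmul, tsub_add_cancel_of_le le_sup_left, add_comm]
  have hv : v = w + ltmul m (st.poly l) (st.poly k) := by
    refine add_right_cancel (b := m.degree (st.poly l)) ?_
    rw [hdeg, hw, add_assoc, ltmul, tsub_add_cancel_of_le le_sup_left, add_comm, sup_comm]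
  have hdom : Dominates m st k l := by
    rw [hu, hv, ← Sig.mul_mul, ← Sig.mul_mul] at hlt
    exact Sig.lt_of_mul hlt
  -- A defect of a component would pass to its w-multiple. Both components are thus free of defects,
  -- against the redundancy of the pair.
  have key : ∀ (a : ℕ) (x y : Fin n →₀ ℕ), x = w + y → ¬ HasLaterRule st x a →
      monomial x 1 * st.poly a ∉ low m f ((st.sig a).mul x) →
      ¬ (monomial y 1 * st.poly a ∈ low m f ((st.sig a).mul y) ∨ HasLaterRule st y a) := by
    rintro a x y rfl h₁ h₂ (h₃ | h₃)
    · have := monomial_mul_mem_low_mul h₃ w 1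
      rw [← mul_assoc, monomial_mul, one_mul, Sig.mul_mul] at this
      exact h₂ this
    · exact h₁ (h₃.mono_left le_add_self)
  exact (h.redundant k hk l hl hkl hdom).elim (key k u _ hu hku hku') (key l v _ hv hlv hlv')

lemma degree_eq_of_add_ne {p q : MvPolynomial (Fin n) 𝕜} (hp : m.degree (p + q) ≠ m.degree p)
    (hq : m.degree (p + q) ≠ m.degree q) : m.degree q = m.degree p := by
  by_contra hne
  rcases lt_or_gt_of_ne (fun h => hne (m.toSyn.injective h)) with h | h
  · exact hp (m.degree_add_of_lt h)
  · exact hq (m.degree_add_eq_right_of_lt h)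

/-- The scalar c may be zero; then p already lies in `low m f s` and the induction hypothesis
settles the claim. -/
lemma IterationInv.isSigReducible (h : IterationInv m f i st G) (s : Sig n) (hs : 1 ≤ s.idx)
    (hs' : s.idx ≤ i) (p : MvPolynomial (Fin n) 𝕜) (hp : p ≠ 0) (c : 𝕜)
    (hc : p - monomial s.mono c * f s.idx ∈ low m f s) : IsSigReducible m f st G s p := by
  induction hkey : s.key m using WellFoundedLT.induction generalizing s p c with
  | ind x ih =>
    subst hkey
    have hlow : ∀ q ∈ low m f s, q ≠ 0 →
        ∃ t : Sig n, t.LT m s ∧ IsSigReducible m f st G t q := fun q hq hq0 => by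
      obtain ⟨t, ht, hts, d, hd⟩ := (eq_zero_or_exists_of_mem_low hq).resolve_left hq0
      exact ⟨t, hts, ih _ (Sig.lt_iff_key.1 hts) t ht (hts.idx_le.trans hs') q hq0 d hd rfl⟩
    by_cases hplow : p ∈ low m f s
    · obtain ⟨t, hts, ht⟩ := hlow p hplow hp
      exact ht.mono hts
    obtain ⟨k, u, hk₁, hk₂, hus, hrew⟩ := h.exists_rewriter hs hs'
    have hU := (h.valid.hasSig k hk₁ hk₂).monomial_mul u (one_ne_zero (α := 𝕜))
    rw [hus] at hU
    obtain ⟨a, ha⟩ := hU.exists_sub_mem_low hc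
    have hUlow : monomial u 1 * st.poly k ∉ low m f s := fun hmem => hplow <| by
      have := add_mem ha (Submodule.smul_mem _ a hmem)
      rwa [sub_add_cancel] at this
    -- The rewriter may have been reduced to zero, but then p would have a smaller signature, a case
    -- already settled. Being nonzero, it belongs to G by the covering clause.
    have hk0 : st.poly k ≠ 0 := fun h0 => hUlow (by simp [h0])
    have ha0 : a ≠ 0 := by
      rintro rfl
      exact hplow (by simpa using ha)
    have hkG : k ∈ G := (h.cover k hk₁ hk₂).resolve_right hk0
    have hsmul : a • (monomial u (1 : 𝕜) * st.poly k) = monomial u a * st.poly k := by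
      rw [← smul_mul_assoc, smul_monomial, smul_eq_mul, mul_one]
    rw [hsmul] at ha
    have hdegU : m.degree (monomial u a * st.poly k) = u + m.degree (st.poly k) :=
      degree_monomial_mul hk0 u ha0
    set q := p - monomial u a * st.poly k with hq
    have hpq : monomial u a * st.poly k + q = p := by rw [hq, add_sub_cancel]
    by_cases hdeg : m.degree p = u + m.degree (st.poly k)
    · exact ⟨k, hkG, u, hdeg.symm, by rw [hus]; exact Sig.LT.irrefl _, hrew, by rwa [hus]⟩
    have hq0 : q ≠ 0 := by
      intro hq0
      rw [hq0, add_zero] at hpq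
      exact hdeg (hpq ▸ hdegU)
    obtain ⟨t, hts, l, hlG, v, hv₁, hv₂, hv₃, hv₄⟩ := hlow q ha hq0
    have hvs : ((st.sig l).mul v).LT m s := by
      rcases Sig.lt_trichotomy m ((st.sig l).mul v) t with h' | h' | h'
      · exact h'.trans hts
      · rwa [h']
      · exact absurd h' hv₂
    by_cases hdeg' : m.degree p = m.degree q
    · exact ⟨l, hlG, v, hv₁.trans hdeg'.symm, fun h' => Sig.LT.irrefl _ (h'.trans hvs), hv₃, hv₄⟩
    -- The head of p comes from neither summand, so the two heads cancel and two good multiples of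
    -- different signatures share a head monomial.
    have hqU : m.degree q = m.degree (monomial u a * st.poly k) :=
      degree_eq_of_add_ne (by rwa [hpq, hdegU]) (by rwa [hpq])
    rw [hdegU] at hqU
    exact absurd (hus ▸ hvs) (h.not_lt_of_degree_eq hkG hlG (hv₁.trans hqU) hrew
      (by rwa [hus]) hv₃ hv₄)

/-- The normalized inputs survive unchanged in G and generate the ideal. Any nonzero element of the
ideal has a signature bound of index at most i, so `IterationInv.isSigReducible` supplies a divisor
of its head monomial. -/
lemma IterationInv.isGroebnerBasis (h : IterationInv m f i st G)
    (hf : ∀ j, 1 ≤ j → j ≤ i → f j ≠ 0) :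
    IsGroebnerBasis m (Ideal.span {p | ∃ j, 1 ≤ j ∧ j ≤ i ∧ p = f j}) G st.poly := by
  refine ⟨le_antisymm ?_ ?_, fun p hp hp0 => ?_⟩
  · rw [Ideal.span_le]
    rintro p ⟨k, hk, rfl⟩
    exact mem_span_of_mem_low (h.poly_mem_low hk)
  · rw [Ideal.span_le]
    rintro p ⟨j, hj, hji, rfl⟩
    obtain ⟨k, hk, -, hpoly⟩ := h.input j hj hji
    have hmem : C (m.leadingCoeff (f j)) * st.poly k ∈ Ideal.span {p | ∃ k ∈ G, p = st.poly k} :=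
      Ideal.mul_mem_left _ _ (Ideal.subset_span ⟨k, hk, rfl⟩)
    rwa [hpoly, monic, ← mul_assoc, ← C_mul,
      mul_inv_cancel₀ (m.leadingCoeff_ne_zero_iff.2 (hf j hj hji)), C_1, one_mul] at hmem
  · obtain ⟨t, ht, hti, c, hc⟩ :=
      (eq_zero_or_exists_of_mem_low (mem_low_of_mem_span (m := m) hp)).resolve_left hp0
    obtain ⟨k, hk, u, hu, -⟩ := h.isSigReducible t ht
      (Nat.le_of_lt_succ (Sig.lt_zero_iff.1 hti)) p hp0 c hc
    exact ⟨k, hk, (h.indexSet k hk).2.2, hu ▸ le_add_self⟩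

/-- Whenever an iteration of `Partial_Basis` terminates, its output is a Gröbner basis. -/
theorem IterationTerminates.isGroebnerBasis {M : ℕ} (hf : ∀ j, 1 ≤ j → j ≤ M → f j ≠ 0)
    (h : IterationTerminates m M f i st G) :
    IsGroebnerBasis m (Ideal.span {p | ∃ j, 1 ≤ j ∧ j ≤ i ∧ p = f j}) G st.poly :=
  (h.iterationInv hf).isGroebnerBasis fun j hj hji => hf j hj (hji.trans h.1)

end Groebner

end

end F5

/-- The conclusion holds for the output of every terminating iteration: a pair whose components are
both minimal and not rewritable was processed, and then recorded a rule that rewrites it. Hence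
the hypothesis `hS` on the `S`-polynomials is not needed. -/
theorem mainTheorem1 {n : ℕ} {𝕜 : Type*} [Field 𝕜] (m : MonomialOrder (Fin n)) (M : ℕ)
    (f : ℕ → MvPolynomial (Fin n) 𝕜) (hf : ∀ j, 1 ≤ j → j ≤ M → f j ≠ 0)
    (i : ℕ) (st : F5.State n 𝕜) (Gcurr : Finset ℕ)
    (hterm : F5.IterationTerminates m M f i st Gcurr)
    (hS : ∀ a ∈ Gcurr, ∀ b ∈ Gcurr, a ≠ b →
      F5.HasSigPreservingSRep m M f st Gcurr a b ∨
      F5.ConditionB m M f i st (F5.ltmul m (st.poly a) (st.poly b)) a ∨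
      F5.ConditionB m M f i st (F5.ltmul m (st.poly b) (st.poly a)) b) :
    F5.IsGroebnerBasis m (Ideal.span {p | ∃ j, 1 ≤ j ∧ j ≤ i ∧ p = f j}) Gcurr st.poly :=
  hterm.isGroebnerBasis hf
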